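/- **Theorem (semi-discrete case).** For all $M>0$ and $R>0$ there exists $C>0$ (depending only on $M$ and $R$) such that the following holds. Let $d\ge 1$ and let $\mu$ be a probability measure on $\mathbb R^d$ whose support is contained in the open ball $B_R$ centered at $0$ with radius $R$, and which has a density with respect to the Lebesgue measure bounded above by $M$. Let $m>1$, let $y_1,\dots,y_m\in B_R$, let $b_1,\dots,b_m>0$ with $\sum_{j=1}^m b_j=1$, and let $\nu=\sum_{j=1}^m b_j\delta_{y_j}$. Let $\Gamma_0(\mathbb R^d)$ be the set of proper lower semicontinuous convex functions $\mathbb R^d\to\mathbb R\cup\{+\infty\}$, write $\varphi^*(y)=\sup_{x}\langle x,y\rangle-\varphi(x)$, and let $\bar\varphi$ be an optimal Brenier potential for $\mu$ and $\nu$, that is, a minimizer of $$\int\varphi\,d\mu+\int\varphi^*\,d\nu\qquad\text{over }\varphi\in\Gamma_0(\mathbb R^d).$$ Then $\bar\varphi$ is differentiable at $\mu$-almost every point, and the following estimate holds for every $n\ge 1$. Let $X_1,\dots,X_n$ be i.i.d. random variables with law $\mu$. Let $(\hat f,\hat g)\in\mathbb R^n\times\mathbb R^m$ be an optimal solution, with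 $\hat g$ depending measurably on the randomness, of the dual linear program for $\hat\mu_n=\frac1n\sum_{i=1}^n\delta_{X_i}$ and $\nu$, $$\max\Big\{\tfrac1n\sum_{i=1}^n f_i+\sum_{j=1}^m b_jg_j\ \Big|\ f_i+g_j\le\tfrac12\|X_i-y_j\|^2\ \text{ for all } i,j\Big\},$$ let $\varphi_{\hat g}(x)=\max_{1\le k\le m}\big(\langle x,y_k\rangle+\hat g_k-\tfrac12\|y_k\|^2\big)$, and let $\hat T_n$ be any selection of the subdifferential of $\varphi_{\hat g}$, i.e. $\hat T_n(x)\in\partial\varphi_{\hat g}(x)$ for all $x\in\mathbb R^d$ (for instance the average of the $y_j$ over the indices $j$ attaining the maximum in $\varphi_{\hat g}(x)$). Then $$\mathbb E\left[\int_{\mathbb R^d}\big\|\nabla\bar\varphi(x)-\hat T_n(x)\big\|\,d\mu(x)\right]\le C\left(\frac mn\right)^{1/8}.$$ -/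

import Mathlib

open MeasureTheory ProbabilityTheory Filter Topology
open scoped ENNReal RealInnerProductSpace

noncomputable section

namespace SemiDiscreteOT

/-- `Γ₀(E)`: proper, lower semicontinuous, convex functions `E → ℝ ∪ {+∞}`.
Convexity is convexity of the epigraph. -/
structure IsGammaZero {E : Type*} [NormedAddCommGroup E] [InnerProductSpace ℝ E]
    (φ : E → EReal) : Prop where
  ne_bot : ∀ x, φ x ≠ ⊥
  exists_ne_top : ∃ x, φ x ≠ ⊤
  lowerSemicontinuous : LowerSemicontinuous φ
  convex_epigraph : Convex ℝ {p : E × ℝ | φ p.1 ≤ (p.2 : EReal)}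

/-- The Fenchel-Legendre transform `φ*(y) = sup_x ⟨x, y⟩ - φ(x)`. -/
def fenchelConj {E : Type*} [NormedAddCommGroup E] [InnerProductSpace ℝ E]
    (φ : E → EReal) (y : E) : EReal :=
  ⨆ x : E, ((⟪x, y⟫ : ℝ) : EReal) - φ x

/-- The integral of an extended real valued function, `∫ φ⁺ dμ - ∫ φ⁻ dμ`.
For `φ ∈ Γ₀` (which has an affine minorant) and a compactly supported finite measure
the second term is finite, so the value is the usual integral in `(-∞, +∞]`. -/
def extIntegral {E : Type*} [MeasurableSpace E] (μ : Measure E) (φ : E → EReal) : EReal :=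
  ((∫⁻ x, (φ x).toENNReal ∂μ : ℝ≥0∞) : EReal) - ((∫⁻ x, (-φ x).toENNReal ∂μ : ℝ≥0∞) : EReal)

/-- The objective `∫ φ dμ + ∫ φ* dν` of the (semi-)dual problem. -/
def dualObjective {E : Type*} [NormedAddCommGroup E] [InnerProductSpace ℝ E] [MeasurableSpace E]
    (μ ν : Measure E) (φ : E → EReal) : EReal :=
  extIntegral μ φ + extIntegral ν (fenchelConj φ)

/-- `φ` is an optimal Brenier potential for `μ` and `ν`: it minimizes `∫ φ dμ + ∫ φ* dν`
over `Γ₀`. -/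
def IsBrenierPotential {E : Type*} [NormedAddCommGroup E] [InnerProductSpace ℝ E]
    [MeasurableSpace E] (μ ν : Measure E) (φ : E → EReal) : Prop :=
  IsGammaZero φ ∧ ∀ ψ : E → EReal, IsGammaZero ψ → dualObjective μ ν φ ≤ dualObjective μ ν ψ

/-- `φ` is finite in a neighbourhood of `x` and differentiable at `x`. -/
def IsDifferentiableAt {E : Type*} [NormedAddCommGroup E] [InnerProductSpace ℝ E]
    (φ : E → EReal) (x : E) : Prop :=
  (∀ᶠ z in 𝓝 x, φ z ≠ ⊥ ∧ φ z ≠ ⊤) ∧ DifferentiableAt ℝ (fun z => (φ z).toReal) x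

/-- The gradient of an extended real valued function
(meaningful where `IsDifferentiableAt` holds). -/
def grad {E : Type*} [NormedAddCommGroup E] [InnerProductSpace ℝ E] [CompleteSpace E]
    (φ : E → EReal) (x : E) : E :=
  gradient (fun z => (φ z).toReal) x

/-- `μ` has a density with respect to the Lebesgue measure that is bounded above by `M`. -/
def HasDensityBoundedBy {d : ℕ} (μ : Measure (EuclideanSpace ℝ (Fin d))) (M : ℝ) : Prop :=
  ∃ ρ : EuclideanSpace ℝ (Fin d) → ℝ≥0∞, Measurable ρ ∧ (∀ x, ρ x ≤ ENNReal.ofReal M) ∧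
    μ = volume.withDensity ρ

/-- The discrete measure `∑ j, b j δ_{y j}`. -/
def discreteMeasure {E : Type*} [MeasurableSpace E] {m : ℕ} (b : Fin m → ℝ) (y : Fin m → E) :
    Measure E :=
  ∑ j, ENNReal.ofReal (b j) • Measure.dirac (y j)

/-- Feasibility in the discrete dual linear program: `f i + g j ≤ ‖x i - y j‖² / 2`. -/
def IsDualFeasible {E : Type*} [NormedAddCommGroup E] {n m : ℕ} (x : Fin n → E) (y : Fin m → E)
    (f : Fin n → ℝ) (g : Fin m → ℝ) : Prop :=
  ∀ i j, f i + g j ≤ 1 / 2 * ‖x i - y j‖ ^ 2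

/-- `(f, g)` is optimal for the discrete dual linear program, which maximizes
`⟨f, a⟩ + ⟨g, b⟩` over feasible pairs, for the measures `∑ i, a i δ_{x i}` and
`∑ j, b j δ_{y j}`. -/
def IsDualOptimal {E : Type*} [NormedAddCommGroup E] {n m : ℕ}
    (a : Fin n → ℝ) (x : Fin n → E) (b : Fin m → ℝ) (y : Fin m → E)
    (f : Fin n → ℝ) (g : Fin m → ℝ) : Prop :=
  IsDualFeasible x y f g ∧
    ∀ f' g', IsDualFeasible x y f' g' →
      ∑ i, f' i * a i + ∑ j, g' j * b j ≤ ∑ i, f i * a i + ∑ j, g j * b j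

/-- The affine function `z ↦ ⟨z, y k⟩ + g k - ‖y k‖² / 2`. -/
def affinePiece {E : Type*} [NormedAddCommGroup E] [InnerProductSpace ℝ E] {m : ℕ}
    (y : Fin m → E) (g : Fin m → ℝ) (k : Fin m) (z : E) : ℝ :=
  ⟪z, y k⟫ + g k - 1 / 2 * ‖y k‖ ^ 2

/-- The explicit potential `φ_g(z) = max_k ⟨z, y k⟩ + g k - ‖y k‖² / 2`. -/
def explicitPotential {E : Type*} [NormedAddCommGroup E] [InnerProductSpace ℝ E] {m : ℕ}
    (y : Fin m → E) (g : Fin m → ℝ) (z : E) : ℝ :=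
  ⨆ k, affinePiece y g k z

/-- The subdifferential of a real valued function. -/
def subdifferential {E : Type*} [NormedAddCommGroup E] [InnerProductSpace ℝ E]
    (φ : E → ℝ) (x : E) : Set E :=
  {v | ∀ z, φ x + ⟪v, z - x⟫ ≤ φ z}

/-- `T` is a Monge map estimator for the discrete measures `∑ i, a i δ_{x i}` and
`∑ j, b j δ_{y j}`, built from `g`: `g` is (the second part of) an optimal solution of the
discrete dual linear program and `T` is a selection of the subdifferential of `φ_g`. -/
def IsMongeMapEstimator {E : Type*} [NormedAddCommGroup E] [InnerProductSpace ℝ E] {n m : ℕ}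
    (a : Fin n → ℝ) (x : Fin n → E) (b : Fin m → ℝ) (y : Fin m → E)
    (g : Fin m → ℝ) (T : E → E) : Prop :=
  (∃ f, IsDualOptimal a x b y f g) ∧ ∀ z, T z ∈ subdifferential (explicitPotential y g) z

open Classical in
/-- The set `I(z)` of active indices. -/
def activeIndices {E : Type*} [NormedAddCommGroup E] [InnerProductSpace ℝ E] {m : ℕ}
    (y : Fin m → E) (g : Fin m → ℝ) (z : E) : Finset (Fin m) :=
  Finset.univ.filter fun j => explicitPotential y g z = affinePiece y g j z

/-- The average of the `y j` over the active indices. -/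
def averageSelection {E : Type*} [NormedAddCommGroup E] [InnerProductSpace ℝ E] {m : ℕ}
    (y : Fin m → E) (g : Fin m → ℝ) (z : E) : E :=
  ((activeIndices y g z).card : ℝ)⁻¹ • ∑ j ∈ activeIndices y g z, y j

/-- The average over the active indices is one of the selections that `IsMongeMapEstimator`
allows. -/
theorem averageSelection_mem_subdifferential {E : Type*} [NormedAddCommGroup E]
    [InnerProductSpace ℝ E] {m : ℕ} (hm : 0 < m) (y : Fin m → E) (g : Fin m → ℝ) (x : E) :
    averageSelection y g x ∈ subdifferential (explicitPotential y g) x := by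
  have : Nonempty (Fin m) := ⟨⟨0, hm⟩⟩
  have hne : (activeIndices y g x).Nonempty := by
    obtain ⟨j, hj⟩ := exists_eq_ciSup_of_finite (f := fun k => affinePiece y g k x)
    exact ⟨j, by simp only [activeIndices, Finset.mem_filter]; exact ⟨Finset.mem_univ _, hj.symm⟩⟩
  intro z
  have hc : (0 : ℝ) < ((activeIndices y g x).card : ℝ) := by exact_mod_cast hne.card_pos
  have key : ∀ j ∈ activeIndices y g x,
      ⟪y j, z - x⟫ ≤ explicitPotential y g z - explicitPotential y g x := by
    intro j hj
    simp only [activeIndices, Finset.mem_filter] at hj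
    have h1 : affinePiece y g j z ≤ explicitPotential y g z :=
      le_ciSup (f := fun k => affinePiece y g k z) (Set.finite_range _).bddAbove j
    rw [hj.2]
    unfold affinePiece at *
    rw [inner_sub_right, real_inner_comm z (y j), real_inner_comm x (y j)]
    linarith
  have hs := Finset.sum_le_sum key
  rw [Finset.sum_const, nsmul_eq_mul] at hs
  have : ⟪averageSelection y g x, z - x⟫
      ≤ explicitPotential y g z - explicitPotential y g x := by
    unfold averageSelection
    rw [real_inner_smul_left, sum_inner, inv_mul_le_iff₀ hc]
    exact hs
  linarith

end SemiDiscreteOT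

end

/-!
Write `φ_g = explicitPotential y g`. An optimal Brenier potential `φ` dominates `φ_g'` for the
weights `g' j = ‖y j‖² / 2 - φ* (y j)`, and `φ_g'` competes with `φ`; hence `φ = φ_g'` almost
everywhere, and `g'` minimizes the semi-dual objective
`J g = ∫ φ_g dμ + ∑ j, b j (‖y j‖² / 2 - g j)`.

*Stability.* At a point `x`, the slope that is active for `(g + g') / 2` is a subgradient of both
`φ_g` and `φ_g'` up to the gap of `φ_· x` in midpoint convexity, so the distance between `∇φ_g` and
`∇φ_g'` is controlled, for each step `t`, by the second differences of step `t` and by this gap,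
divided by `t`. As `μ` has bounded density, the second differences of the Lipschitz convex functions
`φ_g`, `φ_g'` have integral `O(t²)`; by minimality of `g'` the integral of the gap is at most
`(J g - J g') / 2`. Hence `∫ ‖∇φ_g - ∇φ_g'‖ dμ ≲ t + (J g - J g') / t`.

*Statistics.* The estimator minimizes the empirical version of `J`, so `J g - J g'` is at most a
difference of deviations between expectations and empirical means of `φ_h`. Up to an additive
constant the weights stay in a box of side `O(R²)`, and a maximal inequality over an `ε`-net of it
bounds the expected gap by a multiple of `ε + √(m / (n ε))`. The choice `ε = t² = (m / n) ^ (1 / 3)`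
gives the rate `(m / n) ^ (1 / 6)` in each dimension. Only finitely many dimensions occur, because
the volume of the ball of radius `R` tends to `0` as the dimension grows.
-/

open scoped NNReal

noncomputable section

namespace SemiDiscreteOT

section Potential

variable {E : Type*} [NormedAddCommGroup E] [InnerProductSpace ℝ E] {m : ℕ}

theorem affinePiece_le_explicitPotential (y : Fin m → E) (g : Fin m → ℝ) (k : Fin m) (z : E) :
    affinePiece y g k z ≤ explicitPotential y g z :=
  le_ciSup (f := fun k => affinePiece y g k z) (Set.finite_range _).bddAbove k

theorem affinePiece_eq_add_inner (y : Fin m → E) (g : Fin m → ℝ) (k : Fin m) (x z : E) :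
    affinePiece y g k z = affinePiece y g k x + ⟪y k, z - x⟫ := by
  rw [affinePiece, affinePiece, inner_sub_right, real_inner_comm z, real_inner_comm x]
  ring

theorem mem_subdifferential_of_affinePiece_eq {y : Fin m → E} {g : Fin m → ℝ} {k : Fin m} {x : E}
    (h : affinePiece y g k x = explicitPotential y g x) :
    y k ∈ subdifferential (explicitPotential y g) x := fun z => by
  rw [← h, ← affinePiece_eq_add_inner]
  exact affinePiece_le_explicitPotential y g k z

theorem norm_le_of_mem_subdifferential {φ : E → ℝ} {K : ℝ≥0} (hφ : LipschitzWith K φ) {x v : E}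
    (hv : v ∈ subdifferential φ x) : ‖v‖ ≤ K := by
  have hgrowth : φ x + ‖v‖ ^ 2 ≤ φ (x + v) := by
    simpa only [add_sub_cancel_left, real_inner_self_eq_norm_sq] using hv (x + v)
  have hlip : φ (x + v) ≤ φ x + K * ‖v‖ := by
    simpa using hφ.le_add_mul (x + v) x
  by_contra! h
  nlinarith [K.coe_nonneg]

theorem fenchelConj_explicitPotential_le (y : Fin m → E) (g : Fin m → ℝ) (j : Fin m) :
    fenchelConj (fun x => (explicitPotential y g x : EReal)) (y j)
      ≤ ((1 / 2 * ‖y j‖ ^ 2 - g j : ℝ) : EReal) := by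
  refine iSup_le fun x => ?_
  have hle := affinePiece_le_explicitPotential y g j x
  unfold affinePiece at hle
  rw [← EReal.coe_sub, EReal.coe_le_coe_iff]
  linarith

variable [NeZero m]

theorem exists_affinePiece_eq_explicitPotential (y : Fin m → E) (g : Fin m → ℝ) (z : E) :
    ∃ k, affinePiece y g k z = explicitPotential y g z :=
  exists_eq_ciSup_of_finite (f := fun k => affinePiece y g k z)

theorem lipschitzWith_explicitPotential {y : Fin m → E} {K : ℝ≥0} (hy : ∀ j, ‖y j‖ ≤ K)
    (g : Fin m → ℝ) : LipschitzWith K (explicitPotential y g) := by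
  refine LipschitzWith.of_le_add_mul K fun x z => ciSup_le fun k => ?_
  have hslope : ⟪y k, x - z⟫ ≤ K * ‖x - z‖ :=
    (real_inner_le_norm _ _).trans (mul_le_mul_of_nonneg_right (hy k) (norm_nonneg _))
  rw [affinePiece_eq_add_inner y g k z x, dist_eq_norm]
  exact add_le_add (affinePiece_le_explicitPotential y g k z) hslope

theorem continuous_explicitPotential (y : Fin m → E) (g : Fin m → ℝ) :
    Continuous (explicitPotential y g) :=
  (lipschitzWith_explicitPotential (K := ∑ i, ‖y i‖₊) (fun j => by
    exact_mod_cast Finset.single_le_sum_of_canonicallyOrdered (f := fun i => ‖y i‖₊)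
      (Finset.mem_univ j)) g).continuous

theorem convexOn_explicitPotential (y : Fin m → E) (g : Fin m → ℝ) :
    ConvexOn ℝ Set.univ (explicitPotential y g) := by
  refine ⟨convex_univ, fun x _ z _ a b ha hb hab => ciSup_le fun k => ?_⟩
  have haffine : affinePiece y g k (a • x + b • z)
      = a • affinePiece y g k x + b • affinePiece y g k z := by
    simp only [affinePiece, inner_add_left, real_inner_smul_left, smul_eq_mul]
    linear_combination (g k - 1 / 2 * ‖y k‖ ^ 2) * (-hab)
  rw [haffine]
  gcongr <;> exact affinePiece_le_explicitPotential y g k _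

theorem lipschitzWith_explicitPotential_weights (y : Fin m → E) (x : E) :
    LipschitzWith 1 fun g => explicitPotential y g x := by
  refine LipschitzWith.of_le_add fun g g' => ciSup_le fun k => ?_
  have hk : g k - g' k ≤ dist g g' := (le_abs_self _).trans (dist_le_pi_dist g g' k)
  have hle := affinePiece_le_explicitPotential y g' k x
  unfold affinePiece at hle ⊢
  linarith

theorem explicitPotential_sub_const (y : Fin m → E) (g : Fin m → ℝ) (c : ℝ) (x : E) :
    explicitPotential y (fun j => g j - c) x = explicitPotential y g x - c := by
  rw [explicitPotential, explicitPotential, ciSup_sub (Set.finite_range _).bddAbove]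
  exact iSup_congr fun k => by unfold affinePiece; ring

theorem abs_explicitPotential_le {y : Fin m → E} {R B : ℝ} (hy : ∀ j, ‖y j‖ ≤ R)
    {g : Fin m → ℝ} (hg : ‖g‖ ≤ B) {x : E} (hx : ‖x‖ ≤ R) :
    |explicitPotential y g x| ≤ 3 / 2 * R ^ 2 + B := by
  obtain ⟨k, hk⟩ := exists_affinePiece_eq_explicitPotential y g x
  have hinner : |⟪x, y k⟫| ≤ R * R :=
    (abs_real_inner_le_norm _ _).trans
      (mul_le_mul hx (hy k) (norm_nonneg _) ((norm_nonneg x).trans hx))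
  have hsq : ‖y k‖ ^ 2 ≤ R ^ 2 := pow_le_pow_left₀ (norm_nonneg _) (hy k) 2
  have hgk : |g k| ≤ B := (norm_le_pi_norm g k).trans hg
  rw [← hk, affinePiece]
  rw [abs_le] at *
  constructor <;> linarith [sq_nonneg ‖y k‖]

theorem isGammaZero_explicitPotential (y : Fin m → E) (g : Fin m → ℝ) :
    IsGammaZero fun x => (explicitPotential y g x : EReal) where
  ne_bot _ := EReal.coe_ne_bot _
  exists_ne_top := ⟨0, EReal.coe_ne_top _⟩
  lowerSemicontinuous :=
    (continuous_coe_real_ereal.comp (continuous_explicitPotential y g)).lowerSemicontinuous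
  convex_epigraph := by
    simpa using (convexOn_explicitPotential y g).convex_epigraph

end Potential

section SecondDifference

/-- The centred second difference of `φ` at `x` with step `h`. -/
def secondDiff {E : Type*} [AddGroup E] (φ : E → ℝ) (h x : E) : ℝ :=
  (φ (x + h) - φ x) - (φ x - φ (x - h))

theorem continuous_secondDiff {E : Type*} [AddGroup E] [TopologicalSpace E]
    [IsTopologicalAddGroup E] {φ : E → ℝ} (hφ : Continuous φ) (h : E) :
    Continuous (secondDiff φ h) := by
  unfold secondDiff
  fun_prop

theorem secondDiff_nonneg {E : Type*} [AddCommGroup E] [Module ℝ E] {φ : E → ℝ}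
    (hφ : ConvexOn ℝ Set.univ φ) (h x : E) : 0 ≤ secondDiff φ h x := by
  have hmid := hφ.2 (Set.mem_univ (x + h)) (Set.mem_univ (x - h))
    (by norm_num : (0 : ℝ) ≤ 1 / 2) (by norm_num : (0 : ℝ) ≤ 1 / 2) (by norm_num)
  rw [show (1 / 2 : ℝ) • (x + h) + (1 / 2 : ℝ) • (x - h) = x by module] at hmid
  simp only [smul_eq_mul] at hmid
  unfold secondDiff
  linarith

variable {E : Type*} [NormedAddCommGroup E] [InnerProductSpace ℝ E]

theorem abs_inner_sub_le_secondDiff {φ : E → ℝ} {x p v : E} {ε : ℝ}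
    (hp : ∀ z, φ x + ⟪p, z - x⟫ ≤ φ z + ε) (hv : v ∈ subdifferential φ x) (h : E) :
    |⟪h, p - v⟫| ≤ secondDiff φ h x + ε := by
  have hp_add := hp (x + h)
  have hp_sub := hp (x - h)
  have hv_add := hv (x + h)
  have hv_sub := hv (x - h)
  rw [add_sub_cancel_left] at hp_add hv_add
  rw [sub_sub_cancel_left, inner_neg_right] at hp_sub hv_sub
  rw [inner_sub_right, real_inner_comm p h, real_inner_comm v h, abs_le]
  unfold secondDiff
  constructor <;> linarith

variable {ι : Type*} [Fintype ι]

theorem norm_le_sum_abs_inner (e : OrthonormalBasis ι ℝ E) (x : E) : ‖x‖ ≤ ∑ i, |⟪e i, x⟫| :=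
  calc ‖x‖ = ‖∑ i, ⟪e i, x⟫ • e i‖ := by rw [e.sum_repr' x]
    _ ≤ ∑ i, ‖⟪e i, x⟫ • e i‖ := norm_sum_le _ _
    _ = ∑ i, |⟪e i, x⟫| := by simp only [norm_smul, e.norm_eq_one, mul_one, Real.norm_eq_abs]

theorem norm_sub_le_sum_secondDiff (e : OrthonormalBasis ι ℝ E) {φ : E → ℝ} {x p v : E} {ε : ℝ}
    (hp : ∀ z, φ x + ⟪p, z - x⟫ ≤ φ z + ε) (hv : v ∈ subdifferential φ x) {t : ℝ} (ht : 0 < t) :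
    ‖p - v‖ ≤ ∑ i, (secondDiff φ (t • e i) x + ε) / t := by
  refine (norm_le_sum_abs_inner e _).trans (Finset.sum_le_sum fun i _ => ?_)
  have hi := abs_inner_sub_le_secondDiff hp hv (t • e i)
  rwa [real_inner_smul_left, abs_mul, abs_of_pos ht, mul_comm, ← le_div_iff₀ ht] at hi

end SecondDifference

section Cutoff

variable {E : Type*} [NormedAddCommGroup E]

/-- The cutoff `max 0 (R + 1 - ‖x‖)`. It is at least `1` on the ball of radius `R`, and being
Lipschitz it can be differentiated once in the discrete integration by parts
`integral_cutoff_mul_secondDiff`. -/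
def cutoff (R : ℝ) (x : E) : ℝ := max 0 (R + 1 - ‖x‖)

theorem lipschitzWith_cutoff (R : ℝ) : LipschitzWith 1 (cutoff R : E → ℝ) := by
  have h := (LipschitzWith.const (R + 1)).sub (lipschitzWith_one_norm (E := E))
  rw [zero_add] at h
  exact h.const_max 0

theorem cutoff_nonneg (R : ℝ) (x : E) : 0 ≤ cutoff R x := le_max_left _ _

theorem one_le_cutoff {R : ℝ} {x : E} (hx : ‖x‖ ≤ R) : 1 ≤ cutoff R x :=
  le_max_of_le_right (by linarith)

theorem cutoff_eq_zero {R : ℝ} {x : E} (hx : R + 1 ≤ ‖x‖) : cutoff R x = 0 :=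
  max_eq_left (by linarith)

theorem abs_cutoff_sub_mul_le {φ : E → ℝ} {K : ℝ≥0} (hφ : LipschitzWith K φ) {h : E}
    (hh : ‖h‖ ≤ 1) (R : ℝ) (x : E) :
    |(cutoff R x - cutoff R (x + h)) * (φ (x + h) - φ x)|
      ≤ (Metric.closedBall (0 : E) (R + 2)).indicator (fun _ => K * ‖h‖ ^ 2) x := by
  by_cases hx : x ∈ Metric.closedBall (0 : E) (R + 2)
  · have hcut : |cutoff R x - cutoff R (x + h)| ≤ ‖h‖ := by
      simpa using (lipschitzWith_cutoff R).norm_sub_le x (x + h)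
    have hinc : |φ (x + h) - φ x| ≤ K * ‖h‖ := by
      simpa using hφ.norm_sub_le (x + h) x
    rw [Set.indicator_of_mem hx, abs_mul]
    calc _ ≤ ‖h‖ * (K * ‖h‖) := mul_le_mul hcut hinc (abs_nonneg _) (norm_nonneg _)
      _ = K * ‖h‖ ^ 2 := by ring
  · rw [Set.indicator_of_notMem hx]
    rw [mem_closedBall_zero_iff, not_le] at hx
    have hxh : ‖x‖ ≤ ‖x + h‖ + ‖h‖ := by simpa using norm_sub_le (x + h) h
    rw [cutoff_eq_zero (by linarith), cutoff_eq_zero (by linarith)]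
    simp

variable [MeasurableSpace E] [BorelSpace E]

theorem ae_norm_le_of_le_smul_restrict {μ ν : Measure E} {M : ℝ≥0∞} {R : ℝ}
    (hμ : μ ≤ M • ν.restrict (Metric.closedBall 0 R)) : ∀ᵐ x ∂μ, ‖x‖ ≤ R := by
  filter_upwards [(Measure.absolutelyContinuous_of_le_smul hμ).ae_le
    (ae_restrict_mem measurableSet_closedBall)] with x hx using mem_closedBall_zero_iff.1 hx

theorem integrable_of_continuous_of_ae_norm_le [ProperSpace E] {μ : Measure E} [IsFiniteMeasure μ]
    {R : ℝ} (hμ : ∀ᵐ x ∂μ, ‖x‖ ≤ R) {f : E → ℝ} (hf : Continuous f) : Integrable f μ := by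
  have hball : ∀ᵐ x ∂μ, x ∈ Metric.closedBall (0 : E) R := by
    simpa only [mem_closedBall_zero_iff] using hμ
  rw [← Measure.restrict_eq_self_of_ae_mem hball]
  exact hf.continuousOn.integrableOn_compact (isCompact_closedBall _ _)

variable [NormedSpace ℝ E] [FiniteDimensional ℝ E] (ν : Measure E) [ν.IsAddHaarMeasure]

theorem integrable_cutoff_mul (R : ℝ) {f : E → ℝ} (hf : Continuous f) :
    Integrable (fun x => cutoff R x * f x) ν := by
  have : ProperSpace E := FiniteDimensional.proper ℝ E
  refine ((lipschitzWith_cutoff R).continuous.mul hf).integrable_of_hasCompactSupport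
    (HasCompactSupport.intro (isCompact_closedBall (0 : E) (R + 1)) fun x hx => ?_)
  rw [mem_closedBall_zero_iff, not_le] at hx
  rw [Pi.mul_apply, cutoff_eq_zero hx.le, zero_mul]

theorem integral_cutoff_mul_secondDiff (R : ℝ) {φ : E → ℝ} (hφ : Continuous φ) (h : E) :
    ∫ x, cutoff R x * secondDiff φ h x ∂ν
      = ∫ x, (cutoff R x - cutoff R (x + h)) * (φ (x + h) - φ x) ∂ν := by
  have hfwd : Integrable (fun x => cutoff R x * (φ (x + h) - φ x)) ν :=
    integrable_cutoff_mul ν R (by fun_prop)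
  have hbwd : Integrable (fun x => cutoff R x * (φ x - φ (x - h))) ν :=
    integrable_cutoff_mul ν R (by fun_prop)
  have hshift := hbwd.comp_add_right h
  have htranslate := integral_add_right_eq_self (μ := ν)
    (fun x => cutoff R x * (φ x - φ (x - h))) h
  simp only [add_sub_cancel_right] at hshift htranslate
  calc ∫ x, cutoff R x * secondDiff φ h x ∂ν
      = ∫ x, (cutoff R x * (φ (x + h) - φ x) - cutoff R x * (φ x - φ (x - h))) ∂ν := by
        simp only [secondDiff, mul_sub]
    _ = ∫ x, (cutoff R x * (φ (x + h) - φ x) - cutoff R (x + h) * (φ (x + h) - φ x)) ∂ν := by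
        rw [integral_sub hfwd hbwd, integral_sub hfwd hshift, htranslate]
    _ = ∫ x, (cutoff R x - cutoff R (x + h)) * (φ (x + h) - φ x) ∂ν := by simp only [sub_mul]

theorem integral_cutoff_mul_secondDiff_le {φ : E → ℝ} {K : ℝ≥0} (hφ : LipschitzWith K φ) (R : ℝ)
    {h : E} (hh : ‖h‖ ≤ 1) :
    ∫ x, cutoff R x * secondDiff φ h x ∂ν
      ≤ K * ‖h‖ ^ 2 * ν.real (Metric.closedBall (0 : E) (R + 2)) := by
  have : ProperSpace E := FiniteDimensional.proper ℝ E
  have hpt := abs_cutoff_sub_mul_le hφ hh R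
  have hind : Integrable ((Metric.closedBall (0 : E) (R + 2)).indicator
      fun _ => (K : ℝ) * ‖h‖ ^ 2) ν :=
    (integrable_indicator_iff measurableSet_closedBall).2
      (integrableOn_const measure_closedBall_lt_top.ne)
  calc ∫ x, cutoff R x * secondDiff φ h x ∂ν
      = ∫ x, (cutoff R x - cutoff R (x + h)) * (φ (x + h) - φ x) ∂ν :=
        integral_cutoff_mul_secondDiff ν R hφ.continuous h
    _ ≤ ∫ x, (Metric.closedBall (0 : E) (R + 2)).indicator (fun _ => (K : ℝ) * ‖h‖ ^ 2) x ∂ν := by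
        refine integral_mono (hind.mono' ?_ (ae_of_all _ hpt)) hind
          fun x => (le_abs_self _).trans (hpt x)
        have hc := (lipschitzWith_cutoff (E := E) R).continuous
        have hφc := hφ.continuous
        exact Continuous.aestronglyMeasurable (by fun_prop)
    _ = K * ‖h‖ ^ 2 * ν.real (Metric.closedBall (0 : E) (R + 2)) := by
        rw [integral_indicator_const _ measurableSet_closedBall, smul_eq_mul, mul_comm]

theorem integral_secondDiff_le {μ : Measure E} {M : ℝ≥0} {R : ℝ}
    (hμ : μ ≤ (M : ℝ≥0∞) • ν.restrict (Metric.closedBall 0 R)) {φ : E → ℝ} {K : ℝ≥0}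
    (hφ : LipschitzWith K φ) (hconv : ConvexOn ℝ Set.univ φ) {h : E} (hh : ‖h‖ ≤ 1) :
    ∫ x, secondDiff φ h x ∂μ
      ≤ M * (K * ‖h‖ ^ 2 * ν.real (Metric.closedBall (0 : E) (R + 2))) := by
  have hcont := continuous_secondDiff hφ.continuous h
  have hnonneg := secondDiff_nonneg hconv h
  have hcut : Integrable (fun x => cutoff R x * secondDiff φ h x) ν :=
    integrable_cutoff_mul ν R hcont
  have hcut_nonneg : ∀ x, 0 ≤ cutoff R x * secondDiff φ h x := fun x =>
    mul_nonneg (cutoff_nonneg R x) (hnonneg x)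
  have hbound : ∀ x ∈ Metric.closedBall (0 : E) R,
      secondDiff φ h x ≤ cutoff R x * secondDiff φ h x := fun x hx =>
    le_mul_of_one_le_left (hnonneg x) (one_le_cutoff (mem_closedBall_zero_iff.1 hx))
  have hres : IntegrableOn (secondDiff φ h) (Metric.closedBall (0 : E) R) ν :=
    have : ProperSpace E := FiniteDimensional.proper ℝ E
    hcont.continuousOn.integrableOn_compact (isCompact_closedBall _ _)
  calc ∫ x, secondDiff φ h x ∂μ
      ≤ ∫ x, secondDiff φ h x ∂((M : ℝ≥0∞) • ν.restrict (Metric.closedBall 0 R)) :=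
        integral_mono_measure hμ (ae_of_all _ hnonneg) (hres.smul_measure ENNReal.coe_ne_top)
    _ = M * ∫ x in Metric.closedBall 0 R, secondDiff φ h x ∂ν := by
        rw [integral_smul_measure, ENNReal.coe_toReal, smul_eq_mul]
    _ ≤ M * ∫ x in Metric.closedBall 0 R, cutoff R x * secondDiff φ h x ∂ν := by
        refine mul_le_mul_of_nonneg_left ?_ M.coe_nonneg
        exact setIntegral_mono_on hres hcut.integrableOn measurableSet_closedBall hbound
    _ ≤ M * ∫ x, cutoff R x * secondDiff φ h x ∂ν := by
        refine mul_le_mul_of_nonneg_left ?_ M.coe_nonneg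
        exact setIntegral_le_integral hcut (ae_of_all _ hcut_nonneg)
    _ ≤ M * (K * ‖h‖ ^ 2 * ν.real (Metric.closedBall (0 : E) (R + 2))) := by
        gcongr
        exact integral_cutoff_mul_secondDiff_le ν hφ R hh

end Cutoff

section Stability

variable {E : Type*} [NormedAddCommGroup E] [InnerProductSpace ℝ E] {m : ℕ}

/-- The semi-dual objective `∫ φ_g dμ + ∑ j, b j (‖y j‖² / 2 - g j)`, which is `dualObjective` at
`φ_g` with the conjugates `φ_g* (y j)` replaced by their upper bounds `‖y j‖² / 2 - g j`. -/
def semidual [MeasurableSpace E] (μ : Measure E) (b : Fin m → ℝ) (y : Fin m → E)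
    (g : Fin m → ℝ) : ℝ :=
  ∫ x, explicitPotential y g x ∂μ + ∑ j, b j * (1 / 2 * ‖y j‖ ^ 2 - g j)

/-- The Jensen gap of the convex function `g ↦ φ_g(x)` at the midpoint of `g` and `g'`. -/
def midpointGap (y : Fin m → E) (g g' : Fin m → ℝ) (x : E) : ℝ :=
  (explicitPotential y g x + explicitPotential y g' x) / 2
    - explicitPotential y (fun j => (g j + g' j) / 2) x

theorem midpointGap_comm (y : Fin m → E) (g g' : Fin m → ℝ) :
    midpointGap y g g' = midpointGap y g' g := by
  funext x
  simp only [midpointGap, add_comm]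

theorem explicitPotential_add_inner_le_of_midpoint_active {y : Fin m → E} {g g' : Fin m → ℝ} {x : E}
    {k : Fin m} (hk : affinePiece y (fun j => (g j + g' j) / 2) k x
      = explicitPotential y (fun j => (g j + g' j) / 2) x) (z : E) :
    explicitPotential y g x + ⟪y k, z - x⟫
      ≤ explicitPotential y g z + 2 * midpointGap y g g' x := by
  have hmid : affinePiece y (fun j => (g j + g' j) / 2) k x
      = (affinePiece y g k x + affinePiece y g' k x) / 2 := by
    unfold affinePiece
    ring
  unfold midpointGap
  linarith [affinePiece_le_explicitPotential y g' k x, affinePiece_le_explicitPotential y g k z,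
    affinePiece_eq_add_inner y g k x z]

variable [NeZero m]

/-- A slope `y k` that is active at `x` for the midpoint weights is an approximate subgradient at
`x` of both potentials, so the second differences compare it with `v` and with `w`. -/
theorem norm_sub_le_of_mem_subdifferential {ι : Type*} [Fintype ι] (e : OrthonormalBasis ι ℝ E)
    {y : Fin m → E} {g g' : Fin m → ℝ} {x v w : E}
    (hv : v ∈ subdifferential (explicitPotential y g) x)
    (hw : w ∈ subdifferential (explicitPotential y g') x) {t : ℝ} (ht : 0 < t) :
    ‖w - v‖ ≤ ∑ i, (secondDiff (explicitPotential y g) (t • e i) x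
      + secondDiff (explicitPotential y g') (t • e i) x + 4 * midpointGap y g g' x) / t := by
  obtain ⟨k, hk⟩ := exists_affinePiece_eq_explicitPotential y (fun j => (g j + g' j) / 2) x
  have hkv := norm_sub_le_sum_secondDiff e
    (explicitPotential_add_inner_le_of_midpoint_active hk) hv ht
  have hkw := norm_sub_le_sum_secondDiff e
    (explicitPotential_add_inner_le_of_midpoint_active (g := g') (g' := g)
      (by simpa only [add_comm] using hk)) hw ht
  calc ‖w - v‖ = ‖(y k - v) - (y k - w)‖ := by rw [sub_sub_sub_cancel_left]
    _ ≤ ‖y k - v‖ + ‖y k - w‖ := norm_sub_le _ _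
    _ ≤ _ := add_le_add hkv hkw
    _ = _ := by
      rw [midpointGap_comm y g' g, ← Finset.sum_add_distrib]
      exact Finset.sum_congr rfl fun i _ => by ring

theorem continuous_midpointGap (y : Fin m → E) (g g' : Fin m → ℝ) :
    Continuous (midpointGap y g g') := by
  have := continuous_explicitPotential y g
  have := continuous_explicitPotential y g'
  have := continuous_explicitPotential y fun j => (g j + g' j) / 2
  unfold midpointGap
  fun_prop

variable [FiniteDimensional ℝ E] [MeasurableSpace E] [BorelSpace E] {μ : Measure E}

theorem integrable_explicitPotential [IsFiniteMeasure μ] {R : ℝ} (hμ : ∀ᵐ x ∂μ, ‖x‖ ≤ R)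
    (y : Fin m → E) (g : Fin m → ℝ) : Integrable (explicitPotential y g) μ :=
  have : ProperSpace E := FiniteDimensional.proper ℝ E
  integrable_of_continuous_of_ae_norm_le hμ (continuous_explicitPotential y g)

theorem two_mul_integral_midpointGap [IsFiniteMeasure μ] {R : ℝ} (hμ : ∀ᵐ x ∂μ, ‖x‖ ≤ R)
    (b : Fin m → ℝ) (y : Fin m → E) (g g' : Fin m → ℝ) :
    2 * ∫ x, midpointGap y g g' x ∂μ = semidual μ b y g + semidual μ b y g'
      - 2 * semidual μ b y (fun j => (g j + g' j) / 2) := by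
  have hint := integrable_explicitPotential hμ y
  have hlinear : ∑ j, b j * (1 / 2 * ‖y j‖ ^ 2 - (g j + g' j) / 2)
      = (∑ j, b j * (1 / 2 * ‖y j‖ ^ 2 - g j) + ∑ j, b j * (1 / 2 * ‖y j‖ ^ 2 - g' j)) / 2 := by
    rw [← Finset.sum_add_distrib, Finset.sum_div]
    exact Finset.sum_congr rfl fun j _ => by ring
  unfold midpointGap semidual
  rw [integral_sub (((hint g).fun_add (hint g')).div_const 2) (hint _), integral_div,
    integral_add (hint g) (hint g'), hlinear]
  ring

variable [IsFiniteMeasure μ] {M K : ℝ≥0} {R : ℝ}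
  (hμ : μ ≤ (M : ℝ≥0∞) • volume.restrict (Metric.closedBall 0 R))
  {b : Fin m → ℝ} {y : Fin m → E} (hy : ∀ j, ‖y j‖ ≤ K) {g g' : Fin m → ℝ}
  (hmin : ∀ h, semidual μ b y g' ≤ semidual μ b y h)

include hμ

theorem integrable_secondDiff_add_midpointGap (y : Fin m → E) (g g' : Fin m → ℝ) (h : E) :
    Integrable (fun x => secondDiff (explicitPotential y g) h x
      + secondDiff (explicitPotential y g') h x + 4 * midpointGap y g g' x) μ := by
  have : ProperSpace E := FiniteDimensional.proper ℝ E
  have hg := continuous_secondDiff (continuous_explicitPotential y g) h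
  have hg' := continuous_secondDiff (continuous_explicitPotential y g') h
  have hgap := continuous_midpointGap y g g'
  exact integrable_of_continuous_of_ae_norm_le (ae_norm_le_of_le_smul_restrict hμ) (by fun_prop)

include hy hmin

theorem integral_secondDiff_add_midpointGap_le {h : E} (hh : ‖h‖ ≤ 1) :
    ∫ x, (secondDiff (explicitPotential y g) h x + secondDiff (explicitPotential y g') h x
      + 4 * midpointGap y g g' x) ∂μ
      ≤ 2 * (M * (K * ‖h‖ ^ 2 * volume.real (Metric.closedBall (0 : E) (R + 2))))
        + 2 * (semidual μ b y g - semidual μ b y g') := by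
  have : ProperSpace E := FiniteDimensional.proper ℝ E
  have hnorm := ae_norm_le_of_le_smul_restrict hμ
  have hint : ∀ g, Integrable (secondDiff (explicitPotential y g) h) μ := fun g =>
    integrable_of_continuous_of_ae_norm_le hnorm
      (continuous_secondDiff (continuous_explicitPotential y g) h)
  have hgap_int : Integrable (midpointGap y g g') μ :=
    integrable_of_continuous_of_ae_norm_le hnorm (continuous_midpointGap y g g')
  have hsecond : ∀ g, ∫ x, secondDiff (explicitPotential y g) h x ∂μ
      ≤ M * (K * ‖h‖ ^ 2 * volume.real (Metric.closedBall (0 : E) (R + 2))) := fun g =>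
    integral_secondDiff_le volume hμ (lipschitzWith_explicitPotential hy g)
      (convexOn_explicitPotential y g) hh
  have hgap := two_mul_integral_midpointGap hnorm b y g g'
  rw [integral_add ((hint g).fun_add (hint g')) (hgap_int.const_mul 4),
    integral_add (hint g) (hint g'), integral_const_mul]
  linarith [hsecond g, hsecond g', hmin fun j => (g j + g' j) / 2]

theorem lintegral_enorm_sub_le_semidual_gap {v w : E → E}
    (hv : ∀ x, v x ∈ subdifferential (explicitPotential y g) x)
    (hw : ∀ᵐ x ∂μ, w x ∈ subdifferential (explicitPotential y g') x)
    {t : ℝ} (ht : 0 < t) (ht1 : t ≤ 1) :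
    ∫⁻ x, ‖w x - v x‖ₑ ∂μ ≤ ENNReal.ofReal (Module.finrank ℝ E *
      (2 * (M * (K * volume.real (Metric.closedBall (0 : E) (R + 2)))) * t
        + 2 * (semidual μ b y g - semidual μ b y g') / t)) := by
  let e := stdOrthonormalBasis ℝ E
  let F (x : E) : ℝ := ∑ i, (secondDiff (explicitPotential y g) (t • e i) x
      + secondDiff (explicitPotential y g') (t • e i) x + 4 * midpointGap y g g' x) / t
  have hF : ∀ᵐ x ∂μ, ‖w x - v x‖ ≤ F x :=
    hw.mono fun x hx => norm_sub_le_of_mem_subdifferential e (hv x) hx ht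
  have hint := fun i (_ : i ∈ Finset.univ) =>
    (integrable_secondDiff_add_midpointGap hμ y g g' (t • e i)).div_const t
  calc ∫⁻ x, ‖w x - v x‖ₑ ∂μ ≤ ∫⁻ x, ENNReal.ofReal (F x) ∂μ :=
        lintegral_mono_ae <| hF.mono fun x hx => by
          rw [← ofReal_norm]
          exact ENNReal.ofReal_le_ofReal hx
    _ = ENNReal.ofReal (∫ x, F x ∂μ) :=
        (ofReal_integral_eq_lintegral_ofReal (integrable_finsetSum _ hint)
          (hF.mono fun x hx => (norm_nonneg _).trans hx)).symm
    _ ≤ _ := ENNReal.ofReal_le_ofReal ?_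
  rw [integral_finsetSum _ hint]
  refine (Finset.sum_le_card_nsmul _ _ _ fun i _ => ?_).trans_eq
    (by rw [Finset.card_univ, Fintype.card_fin, nsmul_eq_mul])
  have hnorm : ‖t • e i‖ = t := by rw [norm_smul, e.norm_eq_one, mul_one, Real.norm_of_nonneg ht.le]
  have hi := integral_secondDiff_add_midpointGap_le hμ hy hmin (g := g) (h := t • e i)
    (hnorm.trans_le ht1)
  rw [hnorm] at hi
  rw [integral_div, div_le_iff₀ ht, add_mul, div_mul_cancel₀ _ ht.ne']
  linarith

end Stability

section ExtIntegral

variable {E : Type*} [MeasurableSpace E] {μ : Measure E} {φ ψ : E → EReal}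

theorem extIntegral_ne_bot (hneg : ∫⁻ x, (-φ x).toENNReal ∂μ ≠ ⊤) : extIntegral μ φ ≠ ⊥ := by
  unfold extIntegral
  lift ∫⁻ x, (-φ x).toENNReal ∂μ to ℝ≥0 using hneg with r
  rw [sub_eq_add_neg, ne_eq, EReal.add_eq_bot_iff]
  simp

theorem lintegral_toENNReal_ne_top (hneg : ∫⁻ x, (-φ x).toENNReal ∂μ ≠ ⊤)
    (h : extIntegral μ φ ≠ ⊤) : ∫⁻ x, (φ x).toENNReal ∂μ ≠ ⊤ := by
  contrapose! h
  unfold extIntegral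
  lift ∫⁻ x, (-φ x).toENNReal ∂μ to ℝ≥0 using hneg with r
  rw [h, EReal.coe_ennreal_top]
  exact EReal.top_sub_coe r

theorem extIntegral_congr_ae (h : φ =ᵐ[μ] ψ) : extIntegral μ φ = extIntegral μ ψ := by
  unfold extIntegral
  congr 2 <;> exact lintegral_congr_ae (h.mono fun x hx => by simp only [hx])

theorem extIntegral_coe {f : E → ℝ} (hf : Integrable f μ) :
    extIntegral μ (fun x => (f x : EReal)) = ((∫ x, f x ∂μ : ℝ) : EReal) := by
  unfold extIntegral
  simp only [← EReal.coe_neg, EReal.real_coe_toENNReal]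
  have hpos : ∫⁻ x, ENNReal.ofReal (f x) ∂μ ≠ ⊤ := hf.lintegral_lt_top.ne
  have hneg : ∫⁻ x, ENNReal.ofReal (-f x) ∂μ ≠ ⊤ := hf.neg.lintegral_lt_top.ne
  rw [integral_eq_lintegral_pos_part_sub_lintegral_neg_part hf, EReal.coe_sub,
    EReal.coe_ennreal_toReal hpos, EReal.coe_ennreal_toReal hneg]

theorem ae_eq_coe_toReal (hφ : Measurable φ) (hpos : ∫⁻ x, (φ x).toENNReal ∂μ ≠ ⊤)
    (hneg : ∫⁻ x, (-φ x).toENNReal ∂μ ≠ ⊤) : φ =ᵐ[μ] fun x => ((φ x).toReal : EReal) := by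
  filter_upwards [ae_lt_top hφ.ereal_toENNReal hpos, ae_lt_top hφ.neg.ereal_toENNReal hneg]
    with x hx hx'
  refine (EReal.coe_toReal (EReal.toENNReal_ne_top_iff.1 hx.ne) ?_).symm
  exact mt EReal.neg_eq_top_iff.2 (EReal.toENNReal_ne_top_iff.1 hx'.ne)

theorem enorm_toReal_le_add (x : EReal) : ‖x.toReal‖ₑ ≤ x.toENNReal + (-x).toENNReal := by
  induction x with
  | bot => simp
  | top => simp
  | coe r =>
    rw [← EReal.coe_neg, EReal.real_coe_toENNReal, EReal.real_coe_toENNReal, EReal.toReal_coe,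
      Real.enorm_eq_ofReal_abs]
    rcases abs_cases r with ⟨hr, -⟩ | ⟨hr, -⟩ <;> rw [hr]
    exacts [le_self_add, le_add_self]

theorem integrable_toReal (hφ : Measurable φ) (hpos : ∫⁻ x, (φ x).toENNReal ∂μ ≠ ⊤)
    (hneg : ∫⁻ x, (-φ x).toENNReal ∂μ ≠ ⊤) : Integrable (fun x => (φ x).toReal) μ := by
  refine ⟨hφ.ereal_toReal.aestronglyMeasurable, ?_⟩
  refine (lintegral_mono fun x => enorm_toReal_le_add (φ x)).trans_lt ?_
  rw [lintegral_add_left hφ.ereal_toENNReal]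
  exact ENNReal.add_lt_top.2 ⟨hpos.lt_top, hneg.lt_top⟩

variable [MeasurableSingletonClass E] {m : ℕ}

theorem lintegral_discreteMeasure (b : Fin m → ℝ) (y : Fin m → E) (f : E → ℝ≥0∞) :
    ∫⁻ x, f x ∂(discreteMeasure b y) = ∑ j, ENNReal.ofReal (b j) * f (y j) := by
  simp [discreteMeasure, lintegral_finsetSum_measure]

theorem ae_discreteMeasure (b : Fin m → ℝ) {y : Fin m → E} {p : E → Prop} (h : ∀ j, p (y j)) :
    ∀ᵐ x ∂(discreteMeasure b y), p x := by
  simp [ae_iff, discreteMeasure, h]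

theorem integrable_discreteMeasure (b : Fin m → ℝ) (y : Fin m → E) (f : E → ℝ) :
    Integrable f (discreteMeasure b y) :=
  integrable_finsetSum_measure.2 fun _ _ =>
    (integrable_dirac enorm_lt_top).smul_measure ENNReal.ofReal_ne_top

theorem integral_discreteMeasure {b : Fin m → ℝ} (hb : ∀ j, 0 ≤ b j) (y : Fin m → E)
    (f : E → ℝ) : ∫ x, f x ∂(discreteMeasure b y) = ∑ j, b j * f (y j) := by
  unfold discreteMeasure
  rw [integral_finsetSum_measure fun _ _ =>
    (integrable_dirac enorm_lt_top).smul_measure ENNReal.ofReal_ne_top]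
  simp [ENNReal.toReal_ofReal (hb _)]

theorem extIntegral_discreteMeasure {b : Fin m → ℝ} (hb : ∀ j, 0 ≤ b j) {y : Fin m → E}
    (hbot : ∀ j, φ (y j) ≠ ⊥) (htop : ∀ j, φ (y j) ≠ ⊤) :
    extIntegral (discreteMeasure b y) φ = ((∑ j, b j * (φ (y j)).toReal : ℝ) : EReal) := by
  have hcoe : ∀ᵐ x ∂(discreteMeasure b y), φ x = ((φ x).toReal : EReal) :=
    ae_discreteMeasure b fun j => (EReal.coe_toReal (htop j) (hbot j)).symm
  rw [extIntegral_congr_ae hcoe, extIntegral_coe (integrable_discreteMeasure b y _),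
    integral_discreteMeasure hb]

end ExtIntegral

section Brenier

variable {E : Type*} [NormedAddCommGroup E] [InnerProductSpace ℝ E] {m : ℕ} {φ : E → EReal}

theorem fenchelConj_ne_bot (hφ : ∃ x, φ x ≠ ⊤) (y : E) : fenchelConj φ y ≠ ⊥ := by
  obtain ⟨x, hx⟩ := hφ
  have hle : ((⟪x, y⟫ : ℝ) : EReal) - φ x ≤ fenchelConj φ y :=
    le_iSup (fun x : E => ((⟪x, y⟫ : ℝ) : EReal) - φ x) x
  refine ne_bot_of_le_ne_bot ?_ hle
  rw [sub_eq_add_neg, ne_eq, EReal.add_eq_bot_iff]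
  simp [hx]

/-- The weights `g` for which `⟨·, y j⟩ + g j - ‖y j‖² / 2` is the largest affine minorant of `φ`
with slope `y j`. -/
def conjugateWeights (φ : E → EReal) (y : Fin m → E) (j : Fin m) : ℝ :=
  1 / 2 * ‖y j‖ ^ 2 - (fenchelConj φ (y j)).toReal

theorem explicitPotential_conjugateWeights_le [NeZero m] {y : Fin m → E}
    (htop : ∀ j, fenchelConj φ (y j) ≠ ⊤) (x : E) :
    (explicitPotential y (conjugateWeights φ y) x : EReal) ≤ φ x := by
  obtain ⟨k, hk⟩ := exists_affinePiece_eq_explicitPotential y (conjugateWeights φ y) x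
  have hconj : ((⟪x, y k⟫ : ℝ) : EReal) - φ x ≤ ((fenchelConj φ (y k)).toReal : EReal) :=
    (le_iSup (fun x : E => ((⟪x, y k⟫ : ℝ) : EReal) - φ x) x).trans (EReal.le_coe_toReal (htop k))
  rw [← hk]
  unfold affinePiece conjugateWeights
  induction hx : φ x with
  | bot =>
    rw [hx, EReal.coe_sub_bot, top_le_iff] at hconj
    exact absurd hconj (EReal.coe_ne_top _)
  | top => exact le_top
  | coe r =>
    rw [hx, ← EReal.coe_sub, EReal.coe_le_coe_iff] at hconj
    rw [EReal.coe_le_coe_iff]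
    linarith

variable [MeasurableSpace E] {μ : Measure E}

theorem semidual_conjugateWeights (μ : Measure E) (b : Fin m → ℝ) (y : Fin m → E) (φ : E → EReal) :
    semidual μ b y (conjugateWeights φ y) = ∫ x, explicitPotential y (conjugateWeights φ y) x ∂μ
      + ∑ j, b j * (fenchelConj φ (y j)).toReal := by
  simp only [semidual, conjugateWeights, sub_sub_cancel]

theorem IsGammaZero.lintegral_toENNReal_neg_ne_top [ProperSpace E] [IsFiniteMeasure μ] {R : ℝ}
    (hφ : IsGammaZero φ) (hμ : ∀ᵐ x ∂μ, ‖x‖ ≤ R) : ∫⁻ x, (-φ x).toENNReal ∂μ ≠ ⊤ := by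
  obtain ⟨a, -, ha⟩ := (hφ.lowerSemicontinuous.lowerSemicontinuousOn _).exists_isMinOn
    ⟨0, Metric.mem_closedBall_self (abs_nonneg R)⟩ (isCompact_closedBall (0 : E) |R|)
  have hfin : (-φ a).toENNReal < ⊤ := by
    rw [lt_top_iff_ne_top, EReal.toENNReal_ne_top_iff, ne_eq, EReal.neg_eq_top_iff]
    exact hφ.ne_bot a
  have hle : ∀ᵐ x ∂μ, (-φ x).toENNReal ≤ (-φ a).toENNReal := hμ.mono fun x hx =>
    EReal.toENNReal_le_toENNReal <| EReal.neg_le_neg_iff.2 <| ha <|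
      mem_closedBall_zero_iff.2 (hx.trans (le_abs_self R))
  refine ((lintegral_mono_ae hle).trans_lt ?_).ne
  rw [lintegral_const]
  exact ENNReal.mul_lt_top hfin (measure_lt_top _ _)

variable [BorelSpace E]

theorem lintegral_toENNReal_neg_fenchelConj_ne_top (hφ : ∃ x, φ x ≠ ⊤) (b : Fin m → ℝ)
    (y : Fin m → E) : ∫⁻ x, (-fenchelConj φ x).toENNReal ∂(discreteMeasure b y) ≠ ⊤ := by
  rw [lintegral_discreteMeasure]
  refine ENNReal.sum_ne_top.2 fun j _ => ENNReal.mul_ne_top ENNReal.ofReal_ne_top ?_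
  rw [EReal.toENNReal_ne_top_iff, ne_eq, EReal.neg_eq_top_iff]
  exact fenchelConj_ne_bot hφ _

variable [NeZero m] [FiniteDimensional ℝ E] [IsFiniteMeasure μ] {R : ℝ}
  {b : Fin m → ℝ} {y : Fin m → E}

theorem dualObjective_explicitPotential_le (hμ : ∀ᵐ x ∂μ, ‖x‖ ≤ R) (hb : ∀ j, 0 ≤ b j)
    (y : Fin m → E) (g : Fin m → ℝ) :
    dualObjective μ (discreteMeasure b y) (fun x => (explicitPotential y g x : EReal))
      ≤ (semidual μ b y g : EReal) := by
  have hle := fenchelConj_explicitPotential_le y g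
  have htop := fun j => ne_top_of_le_ne_top (EReal.coe_ne_top _) (hle j)
  have hbot := fun j => fenchelConj_ne_bot (φ := fun x => (explicitPotential y g x : EReal))
    ⟨0, EReal.coe_ne_top _⟩ (y j)
  unfold dualObjective semidual
  rw [extIntegral_coe (integrable_explicitPotential hμ y g),
    extIntegral_discreteMeasure hb hbot htop, ← EReal.coe_add, EReal.coe_le_coe_iff]
  gcongr with j
  · exact hb j
  · exact EReal.toReal_le_toReal (hle j) (hbot j) (EReal.coe_ne_top _)

namespace IsBrenierPotential

variable (hφ : IsBrenierPotential μ (discreteMeasure b y) φ) (hμ : ∀ᵐ x ∂μ, ‖x‖ ≤ R)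

include hφ hμ

theorem dualObjective_le_semidual (hb : ∀ j, 0 ≤ b j) (g : Fin m → ℝ) :
    dualObjective μ (discreteMeasure b y) φ ≤ (semidual μ b y g : EReal) :=
  (hφ.2 _ (isGammaZero_explicitPotential y g)).trans (dualObjective_explicitPotential_le hμ hb y g)

theorem lintegral_toENNReal_ne_top (hb : ∀ j, 0 ≤ b j) :
    ∫⁻ x, (φ x).toENNReal ∂μ ≠ ⊤ ∧
      ∫⁻ x, (fenchelConj φ x).toENNReal ∂(discreteMeasure b y) ≠ ⊤ := by
  have : ProperSpace E := FiniteDimensional.proper ℝ E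
  have hneg := hφ.1.lintegral_toENNReal_neg_ne_top hμ
  have hneg' := lintegral_toENNReal_neg_fenchelConj_ne_top hφ.1.exists_ne_top b y
  have hsum : extIntegral μ φ + extIntegral (discreteMeasure b y) (fenchelConj φ) ≠ ⊤ :=
    ne_top_of_le_ne_top (EReal.coe_ne_top _) (hφ.dualObjective_le_semidual hμ hb 0)
  obtain ⟨h, h'⟩ := (EReal.add_ne_top_iff_ne_top₂ (extIntegral_ne_bot hneg)
    (extIntegral_ne_bot hneg')).1 hsum
  exact ⟨SemiDiscreteOT.lintegral_toENNReal_ne_top hneg h,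
    SemiDiscreteOT.lintegral_toENNReal_ne_top hneg' h'⟩

theorem fenchelConj_ne_top (hb : ∀ j, 0 < b j) (j : Fin m) : fenchelConj φ (y j) ≠ ⊤ := by
  intro htop
  have hfin := (hφ.lintegral_toENNReal_ne_top hμ fun j => (hb j).le).2
  rw [lintegral_discreteMeasure, ENNReal.sum_ne_top] at hfin
  refine hfin j (Finset.mem_univ j) ?_
  rw [htop, EReal.toENNReal_top, ENNReal.mul_top (ENNReal.ofReal_pos.2 (hb j)).ne']

theorem integrable_toReal (hb : ∀ j, 0 ≤ b j) : Integrable (fun x => (φ x).toReal) μ :=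
  have : ProperSpace E := FiniteDimensional.proper ℝ E
  SemiDiscreteOT.integrable_toReal hφ.1.lowerSemicontinuous.measurable
    (hφ.lintegral_toENNReal_ne_top hμ hb).1 (hφ.1.lintegral_toENNReal_neg_ne_top hμ)

theorem ae_eq_coe_toReal (hb : ∀ j, 0 ≤ b j) : φ =ᵐ[μ] fun x => ((φ x).toReal : EReal) :=
  have : ProperSpace E := FiniteDimensional.proper ℝ E
  SemiDiscreteOT.ae_eq_coe_toReal hφ.1.lowerSemicontinuous.measurable
    (hφ.lintegral_toENNReal_ne_top hμ hb).1 (hφ.1.lintegral_toENNReal_neg_ne_top hμ)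

theorem integral_toReal_add_le_semidual (hb : ∀ j, 0 < b j) (g : Fin m → ℝ) :
    ∫ x, (φ x).toReal ∂μ + ∑ j, b j * (fenchelConj φ (y j)).toReal ≤ semidual μ b y g := by
  have hb' : ∀ j, 0 ≤ b j := fun j => (hb j).le
  have hle := hφ.dualObjective_le_semidual hμ hb' g
  rwa [dualObjective, extIntegral_congr_ae (hφ.ae_eq_coe_toReal hμ hb'),
    extIntegral_coe (hφ.integrable_toReal hμ hb'), extIntegral_discreteMeasure hb'
      (fun j => fenchelConj_ne_bot hφ.1.exists_ne_top (y j)) (hφ.fenchelConj_ne_top hμ hb),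
    ← EReal.coe_add, EReal.coe_le_coe_iff] at hle

theorem ae_explicitPotential_conjugateWeights_le (hb : ∀ j, 0 < b j) :
    ∀ᵐ x ∂μ, explicitPotential y (conjugateWeights φ y) x ≤ (φ x).toReal := by
  filter_upwards [hφ.ae_eq_coe_toReal hμ fun j => (hb j).le] with x hx
  rw [← EReal.coe_le_coe_iff, ← hx]
  exact explicitPotential_conjugateWeights_le (hφ.fenchelConj_ne_top hμ hb) x

theorem semidual_conjugateWeights_le (hb : ∀ j, 0 < b j) (g : Fin m → ℝ) :
    semidual μ b y (conjugateWeights φ y) ≤ semidual μ b y g := by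
  refine le_trans ?_ (hφ.integral_toReal_add_le_semidual hμ hb g)
  rw [semidual_conjugateWeights]
  gcongr ?_ + _
  exact integral_mono_ae (integrable_explicitPotential hμ y _)
    (hφ.integrable_toReal hμ fun j => (hb j).le) (hφ.ae_explicitPotential_conjugateWeights_le hμ hb)

theorem ae_eq_explicitPotential (hb : ∀ j, 0 < b j) :
    ∀ᵐ x ∂μ, φ x = (explicitPotential y (conjugateWeights φ y) x : EReal) := by
  have hb' : ∀ j, 0 ≤ b j := fun j => (hb j).le
  have hle := hφ.ae_explicitPotential_conjugateWeights_le hμ hb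
  have hint := hφ.integrable_toReal hμ hb'
  have hint' := integrable_explicitPotential hμ y (conjugateWeights φ y)
  have hintegral : ∫ x, explicitPotential y (conjugateWeights φ y) x ∂μ = ∫ x, (φ x).toReal ∂μ := by
    refine (integral_mono_ae hint' hint hle).antisymm ?_
    have hopt := hφ.integral_toReal_add_le_semidual hμ hb (conjugateWeights φ y)
    rwa [semidual_conjugateWeights, add_le_add_iff_right] at hopt
  filter_upwards [(integral_eq_iff_of_ae_le hint' hint hle).1 hintegral,
    hφ.ae_eq_coe_toReal hμ hb'] with x hx hx'
  rw [hx', hx]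

end IsBrenierPotential

end Brenier

section Gradient

variable {E : Type*} [NormedAddCommGroup E] [InnerProductSpace ℝ E] {φ : E → EReal}

theorem IsGammaZero.convex_ne_top (hφ : IsGammaZero φ) : Convex ℝ {x | φ x ≠ ⊤} := by
  intro x hx z hz s t hs ht hst
  have h := hφ.convex_epigraph (x := (x, (φ x).toReal)) (EReal.le_coe_toReal hx)
    (y := (z, (φ z).toReal)) (EReal.le_coe_toReal hz) hs ht hst
  exact ne_top_of_le_ne_top (EReal.coe_ne_top _) h

theorem IsGammaZero.convexOn_toReal (hφ : IsGammaZero φ) :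
    ConvexOn ℝ {x | φ x ≠ ⊤} fun x => (φ x).toReal := by
  refine ⟨hφ.convex_ne_top, fun x hx z hz s t hs ht hst => ?_⟩
  have h := hφ.convex_epigraph (x := (x, (φ x).toReal)) (EReal.le_coe_toReal hx)
    (y := (z, (φ z).toReal)) (EReal.le_coe_toReal hz) hs ht hst
  exact EReal.toReal_le_toReal h (hφ.ne_bot _) (EReal.coe_ne_top _)

theorem ae_differentiableAt_of_locallyLipschitzOn {V : Type*} [NormedAddCommGroup V]
    [NormedSpace ℝ V] [FiniteDimensional ℝ V] [MeasurableSpace V] [BorelSpace V] (ν : Measure V)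
    [ν.IsAddHaarMeasure] {s : Set V} (hs : IsOpen s) {f : V → ℝ} (hf : LocallyLipschitzOn s f) :
    ∀ᵐ x ∂ν, x ∈ s → DifferentiableAt ℝ f x := by
  rw [ae_iff]
  refine measure_null_of_locally_null _ fun x hx => ?_
  obtain ⟨hxs, -⟩ := Classical.not_imp.1 hx
  obtain ⟨K, t, ht, hK⟩ := hf hxs
  rw [hs.nhdsWithin_eq hxs] at ht
  refine ⟨_, inter_mem_nhdsWithin _ (interior_mem_nhds.2 ht), ?_⟩
  have hnull := (hK.mono interior_subset).ae_differentiableWithinAt_of_mem (μ := ν)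
  rw [ae_iff] at hnull
  refine measure_mono_null ?_ hnull
  rintro z ⟨hz, hzt⟩ hdiff
  exact hz fun _ => (hdiff hzt).differentiableAt (isOpen_interior.mem_nhds hzt)

theorem IsGammaZero.ae_isDifferentiableAt [FiniteDimensional ℝ E] [MeasurableSpace E]
    [BorelSpace E] {μ ν : Measure E} [ν.IsAddHaarMeasure] (hφ : IsGammaZero φ) (hμ : μ ≪ ν)
    (hfin : ∀ᵐ x ∂μ, φ x ≠ ⊤) : ∀ᵐ x ∂μ, IsDifferentiableAt φ x := by
  have hconv := hφ.convexOn_toReal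
  have hfrontier : ∀ᵐ x ∂ν, x ∉ frontier {x | φ x ≠ ⊤} :=
    measure_eq_zero_iff_ae_notMem.1 (hconv.1.addHaar_frontier ν)
  have hdiff := ae_differentiableAt_of_locallyLipschitzOn ν isOpen_interior
    ((hconv.subset interior_subset hconv.1.interior).locallyLipschitzOn isOpen_interior)
  filter_upwards [hμ.ae_le hfrontier, hμ.ae_le hdiff, hfin] with x hx hx' htop
  have hint : x ∈ interior {x | φ x ≠ ⊤} := by
    by_contra h
    exact hx ⟨subset_closure htop, h⟩
  refine ⟨?_, hx' hint⟩
  filter_upwards [isOpen_interior.mem_nhds hint] with z hz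
  exact ⟨hφ.ne_bot z, interior_subset hz⟩

theorem grad_eq_of_mem_subdifferential [CompleteSpace E] {ψ : E → ℝ} {x v : E}
    (hφ : IsDifferentiableAt φ x) (hle : ∀ z, (ψ z : EReal) ≤ φ z) (heq : φ x = ψ x)
    (hv : v ∈ subdifferential ψ x) : grad φ x = v := by
  obtain ⟨hfin, hdiff⟩ := hφ
  have hgrad : HasGradientAt (fun z => (φ z).toReal) (grad φ x) x := hdiff.hasGradientAt
  have hderiv : HasFDerivAt (fun z => (φ z).toReal - ⟪v, z⟫)
      (InnerProductSpace.toDual ℝ E (grad φ x) - InnerProductSpace.toDual ℝ E v) x :=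
    hgrad.hasFDerivAt.sub (InnerProductSpace.toDual ℝ E v).hasFDerivAt
  have hmin : IsLocalMin (fun z => (φ z).toReal - ⟪v, z⟫) x := by
    filter_upwards [hfin] with z hz
    have hψ : ψ z ≤ (φ z).toReal := EReal.coe_le_coe_iff.1 <|
      (hle z).trans_eq (EReal.coe_toReal hz.2 hz.1).symm
    have hsub := hv z
    rw [inner_sub_right] at hsub
    rw [heq, EReal.toReal_coe]
    linarith
  have hzero := hmin.hasFDerivAt_eq_zero hderiv
  rwa [sub_eq_zero, EmbeddingLike.apply_eq_iff_eq] at hzero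

namespace IsBrenierPotential

variable [FiniteDimensional ℝ E] [MeasurableSpace E] [BorelSpace E] {μ ν : Measure E}
  [IsProbabilityMeasure μ] [ν.IsAddHaarMeasure] {m : ℕ} [NeZero m] {b : Fin m → ℝ} {y : Fin m → E}
  {R : ℝ} (hφ : IsBrenierPotential μ (discreteMeasure b y) φ) (hμ : ∀ᵐ x ∂μ, ‖x‖ ≤ R)
  (hac : μ ≪ ν) (hb : ∀ j, 0 < b j)

include hφ hμ hac hb

theorem ae_isDifferentiableAt : ∀ᵐ x ∂μ, IsDifferentiableAt φ x :=
  hφ.1.ae_isDifferentiableAt hac <| (hφ.ae_eq_explicitPotential hμ hb).mono fun x hx => by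
    rw [hx]
    exact EReal.coe_ne_top _

theorem ae_grad_mem_subdifferential : ∀ᵐ x ∂μ,
    grad φ x ∈ subdifferential (explicitPotential y (conjugateWeights φ y)) x := by
  filter_upwards [hφ.ae_isDifferentiableAt hμ hac hb, hφ.ae_eq_explicitPotential hμ hb]
    with x hdiff heq
  obtain ⟨k, hk⟩ := exists_affinePiece_eq_explicitPotential y (conjugateWeights φ y) x
  have hk' := mem_subdifferential_of_affinePiece_eq hk
  rwa [grad_eq_of_mem_subdifferential hdiff
    (explicitPotential_conjugateWeights_le (hφ.fenchelConj_ne_top hμ hb)) heq hk']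

end IsBrenierPotential

end Gradient

section DiscreteDual

variable {E : Type*} [NormedAddCommGroup E] {n m : ℕ} {a : Fin n → ℝ} {x : Fin n → E}
  {b : Fin m → ℝ} {y : Fin m → E} {f : Fin n → ℝ} {g : Fin m → ℝ}

/-- Otherwise `g j` could be increased. -/
theorem IsDualOptimal.exists_le_add [NeZero n] (h : IsDualOptimal a x b y f g) {j : Fin m}
    (hb : 0 < b j) : ∃ i, 1 / 2 * ‖x i - y j‖ ^ 2 ≤ f i + g j := by
  by_contra! hslack
  obtain ⟨i₀, hi₀⟩ := Finite.exists_min fun i => 1 / 2 * ‖x i - y j‖ ^ 2 - (f i + g j)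
  obtain ⟨η, hη⟩ : ∃ η, η = 1 / 2 * ‖x i₀ - y j‖ ^ 2 - (f i₀ + g j) := ⟨_, rfl⟩
  have hηpos : 0 < η := hη ▸ sub_pos.2 (hslack i₀)
  let g' : Fin m → ℝ := g + Pi.single j η
  have hfeas : IsDualFeasible x y f g' := fun i l => by
    rcases eq_or_ne l j with rfl | hl
    · simp only [g', Pi.add_apply, Pi.single_eq_same]
      linarith [hi₀ i]
    · simp only [g', Pi.add_apply, Pi.single_eq_of_ne hl, add_zero]
      exact h.1 i l
  have hgain : ∑ l, g' l * b l = ∑ l, g l * b l + η * b j := by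
    simp [g', add_mul, Finset.sum_add_distrib, Pi.single_apply]
  linarith [h.2 _ _ hfeas, mul_pos hηpos hb]

theorem IsDualOptimal.sub_le [NeZero n] (h : IsDualOptimal a x b y f g) {R : ℝ}
    (hx : ∀ i, ‖x i‖ ≤ R) (hy : ∀ j, ‖y j‖ ≤ R) {j : Fin m} (hb : 0 < b j) (k : Fin m) :
    g k - g j ≤ 2 * R ^ 2 := by
  obtain ⟨i, hi⟩ := h.exists_le_add hb
  have hdist : ‖x i - y k‖ ^ 2 ≤ (R + R) ^ 2 :=
    pow_le_pow_left₀ (norm_nonneg _) ((norm_sub_le _ _).trans (add_le_add (hx i) (hy k))) 2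
  linarith [h.1 i k, sq_nonneg ‖x i - y j‖]

variable [InnerProductSpace ℝ E]

theorem half_norm_sub_sq (x : E) (y : Fin m → E) (g : Fin m → ℝ) (j : Fin m) :
    1 / 2 * ‖x - y j‖ ^ 2 = 1 / 2 * ‖x‖ ^ 2 - affinePiece y g j x + g j := by
  rw [norm_sub_sq_real, affinePiece]
  ring

theorem isDualFeasible_explicitPotential (x : Fin n → E) (y : Fin m → E) (g : Fin m → ℝ) :
    IsDualFeasible x y (fun i => 1 / 2 * ‖x i‖ ^ 2 - explicitPotential y g (x i)) g := by
  intro i j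
  rw [half_norm_sub_sq (x i) y g j]
  linarith [affinePiece_le_explicitPotential y g j (x i)]

theorem IsDualFeasible.le_sub_explicitPotential [NeZero m] (h : IsDualFeasible x y f g)
    (i : Fin n) : f i ≤ 1 / 2 * ‖x i‖ ^ 2 - explicitPotential y g (x i) := by
  obtain ⟨k, hk⟩ := exists_affinePiece_eq_explicitPotential y g (x i)
  have hfeas := h i k
  rw [half_norm_sub_sq (x i) y g k] at hfeas
  linarith

theorem IsDualOptimal.sum_explicitPotential_sub_le [NeZero m] (h : IsDualOptimal a x b y f g)
    (ha : ∀ i, 0 ≤ a i) (g' : Fin m → ℝ) :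
    ∑ i, explicitPotential y g (x i) * a i - ∑ j, g j * b j
      ≤ ∑ i, explicitPotential y g' (x i) * a i - ∑ j, g' j * b j := by
  have hopt := h.2 _ _ (isDualFeasible_explicitPotential x y g')
  have hf : ∑ i, f i * a i ≤ ∑ i, (1 / 2 * ‖x i‖ ^ 2 - explicitPotential y g (x i)) * a i :=
    Finset.sum_le_sum fun i _ => mul_le_mul_of_nonneg_right (h.1.le_sub_explicitPotential i) (ha i)
  simp only [sub_mul, Finset.sum_sub_distrib] at hopt hf
  linarith

end DiscreteDual

section MaximalInequality

variable {Ω ι : Type*} [MeasurableSpace Ω] {P : Measure Ω} {G : Finset ι} {Z : ι → Ω → ℝ} {c : ℝ≥0}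

theorem integrable_finset_sup' (hG : G.Nonempty) (hZ : ∀ q ∈ G, Integrable (Z q) P) :
    Integrable (fun ω => G.sup' hG fun q => Z q ω) P := by
  have : Integrable (G.sup' hG Z) P :=
    Finset.sup'_induction (p := (Integrable · P)) hG Z (fun _ h₁ _ h₂ => h₁.sup h₂) hZ
  exact this.congr (ae_of_all _ fun ω => Finset.sup'_apply hG Z ω)

/-- Integrate `l * max_q Z q ≤ a - 1 + ∑ q, exp (l * Z q - a)`, with `a` the right-hand side. -/
theorem mul_integral_sup'_le [IsProbabilityMeasure P] (hG : G.Nonempty)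
    (hZ : ∀ q ∈ G, HasSubgaussianMGF (Z q) c P) (l : ℝ) :
    l * ∫ ω, G.sup' hG (fun q => Z q ω) ∂P ≤ Real.log G.card + c * l ^ 2 / 2 := by
  obtain ⟨a, ha⟩ : ∃ a, a = Real.log G.card + c * l ^ 2 / 2 := ⟨_, rfl⟩
  have hpt (ω : Ω) : l * G.sup' hG (fun q => Z q ω)
      ≤ a - 1 + ∑ q ∈ G, Real.exp (l * Z q ω) * Real.exp (-a) := by
    obtain ⟨q, hq, hsup⟩ := G.exists_mem_eq_sup' hG fun q => Z q ω
    have hle : Real.exp (l * Z q ω) * Real.exp (-a) ≤ _ :=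
      Finset.single_le_sum (f := fun q => Real.exp (l * Z q ω) * Real.exp (-a))
        (fun q _ => by positivity) hq
    have hexp := Real.add_one_le_exp (l * Z q ω + -a)
    rw [Real.exp_add] at hexp
    rw [hsup]
    linarith
  have hint : ∀ q ∈ G, Integrable (fun ω => Real.exp (l * Z q ω) * Real.exp (-a)) P :=
    fun q hq => ((hZ q hq).integrable_exp_mul l).mul_const _
  have hmgf : ∀ q ∈ G, ∫ ω, Real.exp (l * Z q ω) * Real.exp (-a) ∂P ≤ (G.card : ℝ)⁻¹ := by
    intro q hq
    have hcard : (0 : ℝ) < G.card := Nat.cast_pos.2 hG.card_pos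
    rw [integral_mul_const]
    calc mgf (Z q) P l * Real.exp (-a) ≤ Real.exp (c * l ^ 2 / 2) * Real.exp (-a) := by
          gcongr
          exact (hZ q hq).mgf_le l
      _ = (G.card : ℝ)⁻¹ := by
          rw [← Real.exp_add, ha, neg_add, add_neg_cancel_comm_assoc, Real.exp_neg,
            Real.exp_log hcard]
  calc l * ∫ ω, G.sup' hG (fun q => Z q ω) ∂P
      ≤ ∫ ω, (a - 1 + ∑ q ∈ G, Real.exp (l * Z q ω) * Real.exp (-a)) ∂P := by
        rw [← integral_const_mul]
        exact integral_mono
          ((integrable_finset_sup' hG fun q hq => (hZ q hq).integrable).const_mul l)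
          ((integrable_const _).add (integrable_finsetSum _ hint)) hpt
    _ = a - 1 + ∑ q ∈ G, ∫ ω, Real.exp (l * Z q ω) * Real.exp (-a) ∂P := by
        rw [integral_add (integrable_const _) (integrable_finsetSum _ hint),
          integral_finsetSum _ hint]
        simp
    _ ≤ a - 1 + ∑ _q ∈ G, (G.card : ℝ)⁻¹ := by
        gcongr with q hq
        exact hmgf q hq
    _ = a := by simp [hG.ne_empty]
    _ = _ := ha

theorem integral_sup'_le_sqrt [IsProbabilityMeasure P] (hG : G.Nonempty)
    (hZ : ∀ q ∈ G, HasSubgaussianMGF (Z q) c P) :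
    ∫ ω, G.sup' hG (fun q => Z q ω) ∂P ≤ √(2 * c * Real.log G.card) := by
  have hdiscrim := discrim_le_zero (a := (c : ℝ) / 2) (c := Real.log G.card)
    (b := -∫ ω, G.sup' hG (fun q => Z q ω) ∂P)
    fun l => by linarith [mul_integral_sup'_le hG hZ l]
  rw [discrim] at hdiscrim
  exact (le_abs_self _).trans (Real.abs_le_sqrt (by linarith))

end MaximalInequality

theorem abs_sub_mul_floor_div_le (h : ℝ) {ε : ℝ} (hε : 0 < ε) : |h - ε * ⌊h / ε⌋| ≤ ε := by
  have hlow : ε * ⌊h / ε⌋ ≤ h := (le_div_iff₀' hε).1 (Int.floor_le _)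
  have hupp : h ≤ ε * (⌊h / ε⌋ + 1) := (div_le_iff₀' hε).1 (Int.lt_floor_add_one _).le
  rw [abs_of_nonneg (sub_nonneg.2 hlow)]
  linarith

theorem floor_mem_Icc_natCast {x : ℝ} {L : ℕ} (hx : |x| ≤ L) : ⌊x⌋ ∈ Finset.Icc (-(L : ℤ)) L := by
  rw [abs_le] at hx
  refine Finset.mem_Icc.2 ⟨Int.le_floor.2 (by exact_mod_cast hx.1), ?_⟩
  exact_mod_cast (Int.floor_le x).trans hx.2

theorem exists_finset_net (ι : Type*) [Fintype ι] {B ε : ℝ} (hB : 0 ≤ B) (hε : 0 < ε) :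
    ∃ G : Finset (ι → ℝ), G.card ≤ (2 * ⌈B / ε⌉₊ + 1) ^ Fintype.card ι ∧
      (∀ q ∈ G, ‖q‖ ≤ B + ε) ∧ ∀ h, ‖h‖ ≤ B → ∃ q ∈ G, ‖h - q‖ ≤ ε := by
  classical
  obtain ⟨L, hL⟩ : ∃ L : ℕ, L = ⌈B / ε⌉₊ := ⟨_, rfl⟩
  let toPoint (z : ι → ℤ) (j : ι) : ℝ := ε * z j
  refine ⟨(Fintype.piFinset fun _ => Finset.Icc (-(L : ℤ)) L).image toPoint,
    Finset.card_image_le.trans_eq ?_, ?_, fun h hh => ?_⟩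
  · rw [Fintype.card_piFinset, Finset.prod_const, Int.card_Icc, Finset.card_univ, hL]
    congr 1
    lia
  · simp only [Finset.forall_mem_image, Fintype.mem_piFinset, Finset.mem_Icc]
    refine fun z hz => (pi_norm_le_iff_of_nonneg (by positivity)).2 fun j => ?_
    calc ‖ε * z j‖ = ε * |(z j : ℝ)| := by
          rw [norm_mul, Real.norm_of_nonneg hε.le, Real.norm_eq_abs]
      _ ≤ ε * (B / ε + 1) := by
        gcongr
        calc |(z j : ℝ)| ≤ L := abs_le.2 (by exact_mod_cast hz j)
          _ ≤ B / ε + 1 := hL ▸ (Nat.ceil_lt_add_one (by positivity)).le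
      _ = B + ε := by rw [mul_add_one, mul_div_cancel₀ _ hε.ne']
  · refine ⟨toPoint fun j => ⌊h j / ε⌋,
      Finset.mem_image_of_mem _ (Fintype.mem_piFinset.2 fun j => floor_mem_Icc_natCast ?_),
      (pi_norm_le_iff_of_nonneg hε.le).2 fun j => abs_sub_mul_floor_div_le (h j) hε⟩
    calc |h j / ε| = ‖h j‖ / ε := by rw [abs_div, abs_of_pos hε, Real.norm_eq_abs]
      _ ≤ B / ε := by gcongr; exact (norm_le_pi_norm h j).trans hh
      _ ≤ L := hL ▸ Nat.le_ceil _

section Deviation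

/-- The deviation `∫ f dμ - (1 / n) ∑ i, f (x i)` of the empirical mean of `f` over the sample `x`
from its mean. -/
def deviation {α : Type*} [MeasurableSpace α] {n : ℕ} (μ : Measure α) (x : Fin n → α)
    (f : α → ℝ) : ℝ :=
  ∫ z, f z ∂μ - ∑ i, f (x i) * (1 / (n : ℝ))

variable {α : Type*} [MeasurableSpace α] {μ : Measure α} {n : ℕ} [NeZero n]

theorem deviation_eq_mul_sum (x : Fin n → α) (f : α → ℝ) :
    deviation μ x f = -(1 / (n : ℝ)) * ∑ i, (f (x i) - ∫ z, f z ∂μ) := by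
  have : (n : ℝ) ≠ 0 := NeZero.ne _
  simp only [deviation, Finset.sum_sub_distrib, ← Finset.sum_mul, Finset.sum_const,
    Finset.card_univ, Fintype.card_fin, nsmul_eq_mul]
  field_simp
  ring

theorem deviation_sub_const [IsProbabilityMeasure μ] (x : Fin n → α) {f : α → ℝ}
    (hf : Integrable f μ) (c : ℝ) : deviation μ x (fun z => f z - c) = deviation μ x f := by
  simp only [deviation_eq_mul_sum, integral_sub hf (integrable_const c), integral_const,
    probReal_univ, one_smul, sub_sub_sub_cancel_right]

theorem deviation_le_add [IsProbabilityMeasure μ] (x : Fin n → α) {f h : α → ℝ} {ε : ℝ}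
    (hf : Integrable f μ) (hh : Integrable h μ) (hfh : ∀ z, |f z - h z| ≤ ε) :
    deviation μ x f ≤ deviation μ x h + 2 * ε := by
  have hmean : ∫ z, f z ∂μ ≤ ∫ z, h z ∂μ + ε := by
    calc ∫ z, f z ∂μ ≤ ∫ z, (h z + ε) ∂μ :=
          integral_mono hf (hh.add (integrable_const ε)) fun z => by
            linarith [(abs_le.1 (hfh z)).2]
      _ = ∫ z, h z ∂μ + ε := by
          rw [integral_add hh (integrable_const ε), integral_const, probReal_univ, one_smul]
  have hsum : ∑ i, (h (x i) - ε) * (1 / (n : ℝ)) ≤ ∑ i, f (x i) * (1 / (n : ℝ)) := by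
    gcongr with i
    linarith [(abs_le.1 (hfh (x i))).1]
  have hconst : ∑ i, (h (x i) - ε) * (1 / (n : ℝ)) = ∑ i, h (x i) * (1 / (n : ℝ)) - ε := by
    have : (n : ℝ) ≠ 0 := NeZero.ne _
    simp only [sub_mul, Finset.sum_sub_distrib, Finset.sum_const, Finset.card_univ,
      Fintype.card_fin, nsmul_eq_mul]
    field_simp
  unfold deviation
  linarith

variable {Ω : Type*} [MeasurableSpace Ω] {P : Measure Ω} {X : Fin n → Ω → α} {f : α → ℝ}

theorem integrable_sub_integral_comp [IsFiniteMeasure P] {Y : Ω → α} (hY : HasLaw Y μ P)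
    (hf : Integrable f μ) : Integrable (fun ω => f (Y ω) - ∫ z, f z ∂μ) P :=
  (Integrable.comp_aemeasurable (hY.map_eq.symm ▸ hf) hY.aemeasurable).sub (integrable_const _)

theorem integrable_deviation [IsFiniteMeasure P] (hX : ∀ i, HasLaw (X i) μ P)
    (hf : Integrable f μ) : Integrable (fun ω => deviation μ (fun i => X i ω) f) P := by
  simp only [deviation_eq_mul_sum]
  exact (integrable_finsetSum _ fun i _ => integrable_sub_integral_comp (hX i) hf).const_mul _

theorem integral_deviation [IsProbabilityMeasure P] (hX : ∀ i, HasLaw (X i) μ P)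
    (hf : Integrable f μ) : ∫ ω, deviation μ (fun i => X i ω) f ∂P = 0 := by
  have hmean (i : Fin n) : ∫ ω, (f (X i ω) - ∫ z, f z ∂μ) ∂P = 0 := by
    have hcomp : Integrable (fun ω => f (X i ω)) P :=
      Integrable.comp_aemeasurable ((hX i).map_eq.symm ▸ hf) (hX i).aemeasurable
    rw [integral_sub hcomp (integrable_const _), integral_const, probReal_univ, one_smul]
    exact sub_eq_zero.2 ((hX i).integral_comp hf.aestronglyMeasurable)
  simp only [deviation_eq_mul_sum, integral_const_mul,
    integral_finsetSum _ fun i _ => integrable_sub_integral_comp (hX i) hf, hmean,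
    Finset.sum_const_zero, mul_zero]

theorem hasSubgaussianMGF_deviation [IsProbabilityMeasure μ] (hX : ∀ i, HasLaw (X i) μ P)
    (hind : iIndepFun X P) (hf : Measurable f) {H : ℝ≥0} (hfH : ∀ᵐ z ∂μ, |f z| ≤ H) :
    HasSubgaussianMGF (fun ω => deviation μ (fun i => X i ω) f) (H ^ 2 / n) P := by
  have hcentered : HasSubgaussianMGF (fun z => f z - ∫ z, f z ∂μ) (H ^ 2) μ := by
    have := hasSubgaussianMGF_of_mem_Icc hf.aemeasurable (hfH.mono fun z hz => abs_le.1 hz)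
    rwa [sub_neg_eq_add, ← two_mul, nnnorm_mul, Real.nnnorm_two, NNReal.nnnorm_eq,
      mul_div_cancel_left₀ _ two_ne_zero] at this
  have hsum := HasSubgaussianMGF.sum_of_iIndepFun (s := Finset.univ)
    (hind.comp (fun _ z => f z - ∫ z, f z ∂μ) fun _ => hf.sub_const _) fun i _ =>
      HasSubgaussianMGF.of_map (hX i).aemeasurable (by rwa [(hX i).map_eq])
  have hconst : NNReal.mk ((-(1 / (n : ℝ))) ^ 2) (sq_nonneg _) * ∑ _i : Fin n, H ^ 2
      = H ^ 2 / n := by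
    have : (n : ℝ) ≠ 0 := NeZero.ne _
    ext
    push_cast [Finset.sum_const, Finset.card_univ, Fintype.card_fin, nsmul_eq_mul]
    field_simp
  simp only [deviation_eq_mul_sum, ← hconst]
  exact hsum.const_mul _

end Deviation

section EmpiricalGap

variable {E : Type*} [NormedAddCommGroup E] [InnerProductSpace ℝ E] [MeasurableSpace E]
  {n m : ℕ} [NeZero m] {μ : Measure E} {b : Fin m → ℝ} {y : Fin m → E}

theorem log_le_of_card_le_pow {N L m : ℕ} (hN : 0 < N) (h : N ≤ (2 * L + 1) ^ m) :
    Real.log N ≤ m * (2 * L) := by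
  calc Real.log N ≤ Real.log ((2 * L + 1) ^ m) :=
        Real.log_le_log (Nat.cast_pos.2 hN) (by exact_mod_cast h)
    _ = m * Real.log (2 * L + 1) := Real.log_pow _ _
    _ ≤ m * (2 * L) := by
        gcongr
        linarith [Real.log_le_sub_one_of_pos (by positivity : (0 : ℝ) < 2 * L + 1)]

theorem IsDualOptimal.semidual_sub_le_deviation_sub {x : Fin n → E} {f : Fin n → ℝ}
    {g : Fin m → ℝ} (h : IsDualOptimal (fun _ => 1 / (n : ℝ)) x b y f g) (g' : Fin m → ℝ) :
    semidual μ b y g - semidual μ b y g'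
      ≤ deviation μ x (explicitPotential y g) - deviation μ x (explicitPotential y g') := by
  have hopt := h.sum_explicitPotential_sub_le (fun _ => by positivity) g'
  simp only [semidual, deviation, mul_comm (b _), sub_mul, Finset.sum_sub_distrib]
  linarith

variable [BorelSpace E] [NeZero n] [IsProbabilityMeasure μ] {Ω : Type*} [MeasurableSpace Ω]
  {P : Measure Ω} [IsProbabilityMeasure P] {X : Fin n → Ω → E} {R : ℝ≥0}

theorem integral_sup'_deviation_le (hμ : ∀ᵐ x ∂μ, ‖x‖ ≤ R) (hX : ∀ i, HasLaw (X i) μ P)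
    (hind : iIndepFun X P) (hy : ∀ j, ‖y j‖ ≤ R) {B : ℝ≥0} {G : Finset (Fin m → ℝ)}
    (hG : G.Nonempty) (hGB : ∀ q ∈ G, ‖q‖ ≤ B) :
    ∫ ω, G.sup' hG (fun q => deviation μ (fun i => X i ω) (explicitPotential y q)) ∂P
      ≤ (3 / 2 * R ^ 2 + B) * √(2 * Real.log G.card / n) := by
  have hsub : ∀ q ∈ G, HasSubgaussianMGF
      (fun ω => deviation μ (fun i => X i ω) (explicitPotential y q))
      ((3 / 2 * R ^ 2 + B) ^ 2 / n) P := fun q hq =>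
    hasSubgaussianMGF_deviation hX hind (continuous_explicitPotential y q).measurable <|
      hμ.mono fun x hx => by exact_mod_cast abs_explicitPotential_le hy (hGB q hq) hx
  refine (integral_sup'_le_sqrt hG hsub).trans_eq ?_
  rw [← Real.sqrt_sq (by positivity : (0 : ℝ) ≤ 3 / 2 * R ^ 2 + B), ← Real.sqrt_mul (sq_nonneg _)]
  congr 1
  push_cast
  ring

theorem exists_finset_net_integral_sup'_deviation_le (hμ : ∀ᵐ x ∂μ, ‖x‖ ≤ R)
    (hX : ∀ i, HasLaw (X i) μ P) (hind : iIndepFun X P) (hy : ∀ j, ‖y j‖ ≤ R) (B : ℝ≥0) {ε : ℝ≥0}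
    (hε : 0 < ε) :
    ∃ (G : Finset (Fin m → ℝ)) (hG : G.Nonempty),
      (∀ h : Fin m → ℝ, ‖h‖ ≤ B → ∃ q ∈ G, ‖h - q‖ ≤ ε) ∧
      ∫ ω, G.sup' hG (fun q => deviation μ (fun i => X i ω) (explicitPotential y q)) ∂P
        ≤ (3 / 2 * R ^ 2 + B + ε) * √(4 * m * (B / ε + 1) / n) := by
  obtain ⟨G, hcard, hGB, hnet⟩ := exists_finset_net (Fin m) B.2 (NNReal.coe_pos.2 hε)
  obtain ⟨q₀, hq₀, -⟩ := hnet 0 (by rw [norm_zero]; exact B.2)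
  have hG : G.Nonempty := ⟨q₀, hq₀⟩
  refine ⟨G, hG, hnet, ?_⟩
  have hlog : 2 * Real.log G.card ≤ 4 * m * (B / ε + 1) := by
    rw [Fintype.card_fin] at hcard
    calc 2 * Real.log G.card ≤ 2 * (m * (2 * ⌈(B : ℝ) / ε⌉₊)) := by
          gcongr
          exact log_le_of_card_le_pow hG.card_pos hcard
      _ ≤ 2 * (m * (2 * (B / ε + 1))) := by
          gcongr
          exact (Nat.ceil_lt_add_one (by positivity)).le
      _ = 4 * m * (B / ε + 1) := by ring
  calc ∫ ω, G.sup' hG (fun q => deviation μ (fun i => X i ω) (explicitPotential y q)) ∂P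
      ≤ (3 / 2 * R ^ 2 + (B + ε : ℝ≥0)) * √(2 * Real.log G.card / n) :=
        integral_sup'_deviation_le hμ hX hind hy hG hGB
    _ ≤ (3 / 2 * R ^ 2 + (B + ε : ℝ≥0)) * √(4 * m * (B / ε + 1) / n) := by gcongr
    _ = _ := by rw [NNReal.coe_add, add_assoc]

variable [FiniteDimensional ℝ E]

theorem deviation_explicitPotential_le_sup' {R : ℝ} (hμ : ∀ᵐ x ∂μ, ‖x‖ ≤ R) (x : Fin n → E)
    {B ε : ℝ} {G : Finset (Fin m → ℝ)} (hG : G.Nonempty)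
    (hnet : ∀ h : Fin m → ℝ, ‖h‖ ≤ B → ∃ q ∈ G, ‖h - q‖ ≤ ε) {g : Fin m → ℝ}
    (hg : ∀ j k, g k - g j ≤ B) :
    deviation μ x (explicitPotential y g)
      ≤ G.sup' hG (fun q => deviation μ x (explicitPotential y q)) + 2 * ε := by
  have hB : 0 ≤ B := by simpa only [sub_self] using hg 0 0
  obtain ⟨q, hqG, hq⟩ := hnet (fun j => g j - g 0) <| (pi_norm_le_iff_of_nonneg hB).2 fun j =>
    abs_sub_le_iff.2 ⟨hg 0 j, hg j 0⟩
  calc deviation μ x (explicitPotential y g)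
      = deviation μ x (explicitPotential y fun j => g j - g 0) := by
        rw [← deviation_sub_const x (integrable_explicitPotential hμ y g) (g 0)]
        exact congrArg _ (funext fun z => (explicitPotential_sub_const y g (g 0) z).symm)
    _ ≤ deviation μ x (explicitPotential y q) + 2 * ε :=
        deviation_le_add x (integrable_explicitPotential hμ y _)
          (integrable_explicitPotential hμ y q) fun z => by
            simpa only [dist_eq_norm, Real.norm_eq_abs, NNReal.coe_one, one_mul] using
              ((lipschitzWith_explicitPotential_weights y z).dist_le_mul _ _).trans
                (by simpa only [NNReal.coe_one, one_mul, dist_eq_norm] using hq)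
    _ ≤ _ := by
        gcongr
        exact Finset.le_sup' (fun q => deviation μ x (explicitPotential y q)) hqG

theorem lintegral_semidual_gap_le (hμ : ∀ᵐ x ∂μ, ‖x‖ ≤ R) (hX : ∀ i, HasLaw (X i) μ P)
    (hind : iIndepFun X P) (hb : ∀ j, 0 < b j) (hy : ∀ j, ‖y j‖ ≤ R) {g' : Fin m → ℝ}
    (hmin : ∀ h, semidual μ b y g' ≤ semidual μ b y h) {g : Ω → Fin m → ℝ}
    (hg : ∀ᵐ ω ∂P, ∃ f, IsDualOptimal (fun _ => 1 / (n : ℝ)) (fun i => X i ω) b y f (g ω))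
    {ε : ℝ≥0} (hε : 0 < ε) :
    ∫⁻ ω, ENNReal.ofReal (semidual μ b y (g ω) - semidual μ b y g') ∂P ≤ ENNReal.ofReal
      (2 * ε + (7 / 2 * R ^ 2 + ε) * √(4 * m * (2 * R ^ 2 / ε + 1) / n)) := by
  obtain ⟨G, hG, hnet, hsup⟩ :=
    exists_finset_net_integral_sup'_deviation_le hμ hX hind hy (2 * R ^ 2) hε
  let Z (q : Fin m → ℝ) (ω : Ω) : ℝ := deviation μ (fun i => X i ω) (explicitPotential y q)
  have hZ (q : Fin m → ℝ) : Integrable (Z q) P :=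
    integrable_deviation hX (integrable_explicitPotential hμ y q)
  let S (ω : Ω) : ℝ := G.sup' hG fun q => Z q ω
  have hS : Integrable S P := integrable_finset_sup' hG fun q _ => hZ q
  have hU : Integrable (fun ω => S ω - Z g' ω + 2 * ε) P :=
    (hS.sub (hZ g')).add (integrable_const _)
  have hgap : ∀ᵐ ω ∂P, semidual μ b y (g ω) - semidual μ b y g' ≤ S ω - Z g' ω + 2 * ε := by
    have hXR : ∀ᵐ ω ∂P, ∀ i, ‖X i ω‖ ≤ R := ae_all_iff.2 fun i =>
      ae_of_ae_map (hX i).aemeasurable ((hX i).map_eq.symm ▸ hμ)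
    filter_upwards [hg, hXR] with ω ⟨f, hf⟩ hω
    linarith [hf.semidual_sub_le_deviation_sub (μ := μ) g',
      deviation_explicitPotential_le_sup' (y := y) hμ (fun i => X i ω) hG hnet
        fun j => by exact_mod_cast hf.sub_le hω hy (hb j)]
  calc ∫⁻ ω, ENNReal.ofReal (semidual μ b y (g ω) - semidual μ b y g') ∂P
      ≤ ∫⁻ ω, ENNReal.ofReal (S ω - Z g' ω + 2 * ε) ∂P :=
        lintegral_mono_ae (hgap.mono fun ω hω => ENNReal.ofReal_le_ofReal hω)
    _ = ENNReal.ofReal (∫ ω, (S ω - Z g' ω + 2 * ε) ∂P) :=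
        (ofReal_integral_eq_lintegral_ofReal hU <|
          hgap.mono fun ω hω => (sub_nonneg.2 (hmin _)).trans hω).symm
    _ = ENNReal.ofReal (∫ ω, S ω ∂P + 2 * ε) := by
        rw [integral_add (hS.sub' (hZ g')) (integrable_const _), integral_sub hS (hZ g'),
          integral_deviation hX (integrable_explicitPotential hμ y g'), sub_zero, integral_const,
          probReal_univ, one_smul]
    _ ≤ _ := ENNReal.ofReal_le_ofReal ?_
  push_cast at hsup
  linarith

end EmpiricalGap

section Dimension

theorem HasDensityBoundedBy.le_smul_restrict {d : ℕ} {μ : Measure (EuclideanSpace ℝ (Fin d))}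
    {M R : ℝ} (h : HasDensityBoundedBy μ M) (hμ : ∀ᵐ x ∂μ, ‖x‖ ≤ R) :
    μ ≤ ENNReal.ofReal M • volume.restrict (Metric.closedBall 0 R) := by
  obtain ⟨ρ, -, hρM, rfl⟩ := h
  have hball := hμ.mono fun x hx => mem_closedBall_zero_iff.2 hx
  rw [← Measure.restrict_eq_self_of_ae_mem hball, ← Measure.restrict_smul, ← withDensity_const]
  exact Measure.restrict_mono_measure (withDensity_mono (ae_of_all _ hρM)) _

theorem tendsto_pow_div_Gamma {c : ℝ} (hc : 0 ≤ c) :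
    Tendsto (fun d : ℕ => c ^ d / Real.Gamma (d / 2 + 1)) atTop (𝓝 0) := by
  set a := max c 1
  have hfactorial :
      Tendsto (fun d : ℕ => a * ((a ^ 2) ^ (d / 2) / (d / 2).factorial)) atTop (𝓝 0) := by
    simpa only [mul_zero, Function.comp_def] using
      ((FloorSemiring.tendsto_pow_div_factorial_atTop (a ^ 2)).comp
        (Nat.tendsto_div_const_atTop two_ne_zero)).const_mul a
  refine squeeze_zero' (Eventually.of_forall fun d => ?_) ?_ hfactorial
  · exact div_nonneg (pow_nonneg hc d) (Real.Gamma_pos_of_pos (by positivity)).le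
  · filter_upwards [eventually_ge_atTop 2] with d hd
    have hhalf : (1 : ℝ) ≤ (d / 2 : ℕ) := by exact_mod_cast show 1 ≤ d / 2 by omega
    have hhalf_le : ((d / 2 : ℕ) : ℝ) ≤ d / 2 := Nat.cast_div_le
    have hGamma : ((d / 2).factorial : ℝ) ≤ Real.Gamma (d / 2 + 1) := by
      rw [← Real.Gamma_nat_eq_factorial]
      exact Real.Gamma_strictMonoOn_Ici.monotoneOn (Set.mem_Ici.2 (by linarith))
        (Set.mem_Ici.2 (by linarith)) (by linarith)
    have hpow : c ^ d ≤ a * (a ^ 2) ^ (d / 2) :=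
      calc c ^ d ≤ a ^ d := pow_le_pow_left₀ hc (le_max_left _ _) d
        _ ≤ a ^ (2 * (d / 2) + 1) := pow_le_pow_right₀ (le_max_right _ _) (by omega)
        _ = a * (a ^ 2) ^ (d / 2) := by rw [pow_succ, pow_mul, mul_comm]
    rw [← mul_div_assoc]
    gcongr

theorem tendsto_volume_closedBall_atTop (R : ℝ≥0) :
    Tendsto (fun d : ℕ => volume (Metric.closedBall (0 : EuclideanSpace ℝ (Fin d)) R)) atTop
      (𝓝 0) := by
  rw [← ENNReal.ofReal_zero]
  refine (ENNReal.tendsto_ofReal (tendsto_pow_div_Gamma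
    (c := R * √Real.pi) (by positivity))).congr' ?_
  filter_upwards [eventually_gt_atTop 0] with d hd
  have : Nonempty (Fin d) := ⟨⟨0, hd⟩⟩
  rw [EuclideanSpace.volume_closedBall, Fintype.card_fin, ← ENNReal.ofReal_pow R.coe_nonneg,
    ← ENNReal.ofReal_mul (by positivity), mul_pow, mul_div_assoc]

theorem exists_dimension_bound (M R : ℝ≥0) :
    ∃ d₀ : ℕ, ∀ (d : ℕ) (μ : Measure (EuclideanSpace ℝ (Fin d))) [IsProbabilityMeasure μ],
      μ ≤ (M : ℝ≥0∞) • volume.restrict (Metric.closedBall 0 R) → d < d₀ := by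
  have hlim := ENNReal.Tendsto.const_mul (tendsto_volume_closedBall_atTop R)
    (Or.inr (ENNReal.coe_ne_top (r := M)))
  rw [mul_zero] at hlim
  obtain ⟨d₀, hd₀⟩ := eventually_atTop.1 (hlim.eventually_lt_const one_pos)
  refine ⟨d₀, fun d μ _ hμ => lt_of_not_ge fun hd => (hd₀ d hd).not_ge ?_⟩
  calc 1 = μ Set.univ := measure_univ.symm
    _ ≤ ((M : ℝ≥0∞) • volume.restrict (Metric.closedBall 0 (R : ℝ))) Set.univ := hμ Set.univ
    _ = M * volume (Metric.closedBall (0 : EuclideanSpace ℝ (Fin d)) R) := by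
      rw [Measure.smul_apply, Measure.restrict_apply_univ, smul_eq_mul]

end Dimension

section Rate

variable {E : Type*} [NormedAddCommGroup E] [InnerProductSpace ℝ E] {m : ℕ} [NeZero m]
  {y : Fin m → E} {R : ℝ≥0}

theorem enorm_sub_le_of_mem_subdifferential (hy : ∀ j, ‖y j‖ ≤ R) {g g' : Fin m → ℝ} {x v w : E}
    (hv : v ∈ subdifferential (explicitPotential y g) x)
    (hw : w ∈ subdifferential (explicitPotential y g') x) :
    ‖w - v‖ₑ ≤ ENNReal.ofReal (2 * R) := by
  rw [← ofReal_norm]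
  refine ENNReal.ofReal_le_ofReal ((norm_sub_le w v).trans ?_)
  linarith [norm_le_of_mem_subdifferential (lipschitzWith_explicitPotential hy g) hv,
    norm_le_of_mem_subdifferential (lipschitzWith_explicitPotential hy g') hw]

theorem lintegral_ofReal_add_mul_le {Ω : Type*} [MeasurableSpace Ω] (P : Measure Ω)
    [IsProbabilityMeasure P] {f : Ω → ℝ} {a b c : ℝ} (ha : 0 ≤ a) (hb : 0 ≤ b) (hc : 0 ≤ c)
    (hf : ∫⁻ ω, ENNReal.ofReal (f ω) ∂P ≤ ENNReal.ofReal c) :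
    ∫⁻ ω, ENNReal.ofReal (a + b * f ω) ∂P ≤ ENNReal.ofReal (a + b * c) :=
  calc ∫⁻ ω, ENNReal.ofReal (a + b * f ω) ∂P
      ≤ ∫⁻ ω, (ENNReal.ofReal a + ENNReal.ofReal b * ENNReal.ofReal (f ω)) ∂P := by
        gcongr with ω
        exact ENNReal.ofReal_add_le.trans_eq (by rw [ENNReal.ofReal_mul hb])
    _ = ENNReal.ofReal a + ENNReal.ofReal b * ∫⁻ ω, ENNReal.ofReal (f ω) ∂P := by
        rw [lintegral_add_left measurable_const, lintegral_const, measure_univ, mul_one,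
          lintegral_const_mul' _ _ ENNReal.ofReal_ne_top]
    _ ≤ ENNReal.ofReal a + ENNReal.ofReal b * ENNReal.ofReal c := by gcongr
    _ = ENNReal.ofReal (a + b * c) := by
        rw [← ENNReal.ofReal_mul hb, ← ENNReal.ofReal_add ha (mul_nonneg hb hc)]

variable [FiniteDimensional ℝ E] [MeasurableSpace E] [BorelSpace E]

variable (E) in
/-- The constant of the convergence rate on `E`, for densities bounded by `M` on the ball of
radius `R`: the sum of the trivial bound `2 * R` and of the constant for `m ≤ n`. -/
def rateConst (M R : ℝ≥0) : ℝ :=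
  2 * R + Module.finrank ℝ E * (2 * (M * (R * volume.real (Metric.closedBall (0 : E) (R + 2))))
    + 2 * (2 + (7 * R ^ 2 + 2) * √(2 * R ^ 2 + 1)))

variable (E) in
theorem rateConst_nonneg (M R : ℝ≥0) : 0 ≤ rateConst E M R := by
  unfold rateConst
  positivity

variable {μ : Measure E} [IsProbabilityMeasure μ] {M : ℝ≥0} {n : ℕ} [NeZero n] {Ω : Type*}
  [MeasurableSpace Ω] {P : Measure Ω} [IsProbabilityMeasure P] {X : Fin n → Ω → E}
  {b : Fin m → ℝ} {g' : Fin m → ℝ} {g : Ω → Fin m → ℝ} {w : E → E} {T : Ω → E → E}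

/-- The net of scale `ε = s ^ 2` balances the two terms of `lintegral_semidual_gap_le`. -/
theorem lintegral_semidual_gap_le_mul_sq (hμ : ∀ᵐ x ∂μ, ‖x‖ ≤ R) (hX : ∀ i, HasLaw (X i) μ P)
    (hind : iIndepFun X P) (hb : ∀ j, 0 < b j) (hy : ∀ j, ‖y j‖ ≤ R)
    (hmin : ∀ h, semidual μ b y g' ≤ semidual μ b y h)
    (hg : ∀ᵐ ω ∂P, ∃ f, IsDualOptimal (fun _ => 1 / (n : ℝ)) (fun i => X i ω) b y f (g ω))
    {s : ℝ≥0} (hs : 0 < s) (hs1 : s ≤ 1) (hs6 : (m : ℝ) / n = s ^ 6) :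
    ∫⁻ ω, ENNReal.ofReal (semidual μ b y (g ω) - semidual μ b y g') ∂P
      ≤ ENNReal.ofReal ((2 + (7 * R ^ 2 + 2) * √(2 * R ^ 2 + 1)) * s ^ 2) := by
  refine (lintegral_semidual_gap_le hμ hX hind hb hy hmin hg (pow_pos hs 2)).trans
    (ENNReal.ofReal_le_ofReal ?_)
  have hs2 : (s : ℝ) ^ 2 ≤ 1 := pow_le_one₀ s.coe_nonneg (by exact_mod_cast hs1)
  have hs0 : (s : ℝ) ≠ 0 := by exact_mod_cast hs.ne'
  have harg :
      4 * m * (2 * R ^ 2 / s ^ 2 + 1) / n = (2 * (s : ℝ) ^ 2) ^ 2 * (2 * R ^ 2 + s ^ 2) := by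
    rw [show 4 * (m : ℝ) * (2 * R ^ 2 / s ^ 2 + 1) / n
      = 4 * (m / n) * (2 * R ^ 2 / s ^ 2 + 1) by ring, hs6]
    field_simp
    ring
  have hsqrt : √(4 * m * (2 * R ^ 2 / s ^ 2 + 1) / n) ≤ 2 * (s : ℝ) ^ 2 * √(2 * R ^ 2 + 1) := by
    rw [harg, Real.sqrt_mul (by positivity), Real.sqrt_sq (by positivity)]
    gcongr
  push_cast
  calc 2 * (s : ℝ) ^ 2 + (7 / 2 * R ^ 2 + s ^ 2) * √(4 * m * (2 * R ^ 2 / s ^ 2 + 1) / n)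
      ≤ 2 * (s : ℝ) ^ 2 + (7 / 2 * R ^ 2 + 1) * (2 * (s : ℝ) ^ 2 * √(2 * R ^ 2 + 1)) := by gcongr
    _ = (2 + (7 * R ^ 2 + 2) * √(2 * R ^ 2 + 1)) * s ^ 2 := by ring

theorem lintegral_enorm_sub_le_rateConst_mul
    (hμ : μ ≤ (M : ℝ≥0∞) • volume.restrict (Metric.closedBall 0 R))
    (hX : ∀ i, HasLaw (X i) μ P) (hind : iIndepFun X P) (hb : ∀ j, 0 < b j)
    (hy : ∀ j, ‖y j‖ ≤ R) (hmin : ∀ h, semidual μ b y g' ≤ semidual μ b y h)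
    (hw : ∀ᵐ x ∂μ, w x ∈ subdifferential (explicitPotential y g') x)
    (hT : ∀ᵐ ω ∂P, IsMongeMapEstimator (fun _ => 1 / (n : ℝ)) (fun i => X i ω) b y (g ω) (T ω))
    {s : ℝ≥0} (hs : 0 < s) (hs1 : s ≤ 1) (hs6 : (m : ℝ) / n = s ^ 6) :
    ∫⁻ ω, ∫⁻ x, ‖w x - T ω x‖ₑ ∂μ ∂P ≤ ENNReal.ofReal (rateConst E M R * s) := by
  set D : ℝ := (Module.finrank ℝ E : ℝ)
  set V := volume.real (Metric.closedBall (0 : E) (R + 2))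
  set c : ℝ := 2 + (7 * R ^ 2 + 2) * √(2 * R ^ 2 + 1)
  have hs0 : (0 : ℝ) < s := hs
  calc ∫⁻ ω, ∫⁻ x, ‖w x - T ω x‖ₑ ∂μ ∂P
      ≤ ∫⁻ ω, ENNReal.ofReal (D * (2 * (M * (R * V)) * s)
          + D * 2 / s * (semidual μ b y (g ω) - semidual μ b y g')) ∂P := by
        refine lintegral_mono_ae (hT.mono fun ω hω => ?_)
        refine (lintegral_enorm_sub_le_semidual_gap hμ hy hmin hω.2 hw hs0
          (by exact_mod_cast hs1)).trans_eq (congrArg _ ?_)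
        ring
    _ ≤ ENNReal.ofReal (D * (2 * (M * (R * V)) * s) + D * 2 / s * (c * s ^ 2)) :=
        lintegral_ofReal_add_mul_le P (by positivity) (by positivity) (by positivity) <|
          lintegral_semidual_gap_le_mul_sq (ae_norm_le_of_le_smul_restrict hμ) hX hind hb hy hmin
            (hT.mono fun ω hω => hω.1) hs hs1 hs6
    _ ≤ ENNReal.ofReal (rateConst E M R * s) := by
        refine ENNReal.ofReal_le_ofReal ?_
        have hcancel : D * 2 / s * (c * s ^ 2) = D * (2 * c) * s := by
          field_simp
        rw [hcancel, rateConst]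
        nlinarith [mul_nonneg R.coe_nonneg s.coe_nonneg]

theorem lintegral_enorm_sub_le_rateConst_mul_rpow
    (hμ : μ ≤ (M : ℝ≥0∞) • volume.restrict (Metric.closedBall 0 R))
    (hX : ∀ i, HasLaw (X i) μ P) (hind : iIndepFun X P) (hb : ∀ j, 0 < b j)
    (hy : ∀ j, ‖y j‖ ≤ R) (hmin : ∀ h, semidual μ b y g' ≤ semidual μ b y h)
    (hw : ∀ᵐ x ∂μ, w x ∈ subdifferential (explicitPotential y g') x)
    (hT : ∀ᵐ ω ∂P,
      IsMongeMapEstimator (fun _ => 1 / (n : ℝ)) (fun i => X i ω) b y (g ω) (T ω)) :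
    ∫⁻ ω, ∫⁻ x, ‖w x - T ω x‖ₑ ∂μ ∂P
      ≤ ENNReal.ofReal (rateConst E M R * min 1 ((m : ℝ) / n) ^ (1 / 6 : ℝ)) := by
  have hmn : (0 : ℝ) < m / n :=
    div_pos (Nat.cast_pos.2 (NeZero.pos m)) (Nat.cast_pos.2 (NeZero.pos n))
  rcases le_total 1 ((m : ℝ) / n) with h1 | h1
  · rw [min_eq_left h1, Real.one_rpow, mul_one]
    have hbound : ∫⁻ ω, ∫⁻ x, ‖w x - T ω x‖ₑ ∂μ ∂P ≤ ∫⁻ _, ∫⁻ _, ENNReal.ofReal (2 * R) ∂μ ∂P :=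
      lintegral_mono_ae <| hT.mono fun ω hω => lintegral_mono_ae <| hw.mono fun x hx =>
        enorm_sub_le_of_mem_subdifferential hy (hω.2 x) hx
    rw [lintegral_const, lintegral_const, measure_univ, measure_univ, mul_one, mul_one] at hbound
    refine hbound.trans (ENNReal.ofReal_le_ofReal ?_)
    unfold rateConst
    exact le_add_of_nonneg_right (by positivity)
  · rw [min_eq_right h1]
    lift (m : ℝ) / n to ℝ≥0 using hmn.le with r hr
    have hr6 : (m : ℝ) / n = ((r ^ (1 / 6 : ℝ) : ℝ≥0) : ℝ) ^ 6 := by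
      rw [← hr, ← NNReal.coe_pow, ← NNReal.rpow_mul_natCast]
      norm_num
    exact lintegral_enorm_sub_le_rateConst_mul hμ hX hind hb hy hmin hw hT
      (NNReal.rpow_pos hmn) (NNReal.rpow_le_one h1 (by norm_num)) hr6

theorem min_one_rpow_le_rpow {r p q : ℝ} (hr : 0 < r) (hq : 0 ≤ q) (hqp : q ≤ p) :
    min 1 r ^ p ≤ r ^ q :=
  (Real.rpow_le_rpow_of_exponent_ge (lt_min one_pos hr) (min_le_left _ _) hqp).trans
    (Real.rpow_le_rpow (lt_min one_pos hr).le (min_le_right _ _) hq)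

end Rate

end SemiDiscreteOT

end

open SemiDiscreteOT in
theorem mainTheorem6_general (M R : ℝ≥0) :
    ∃ C : ℝ, 0 < C ∧
      ∀ (d : ℕ) (μ : Measure (EuclideanSpace ℝ (Fin d))) [IsProbabilityMeasure μ]
        (_ : μ.support ⊆ Metric.closedBall 0 R) (_ : HasDensityBoundedBy μ M)
        (m : ℕ) (_ : 0 < m) (b : Fin m → ℝ) (_ : ∀ j, 0 < b j)
        (y : Fin m → EuclideanSpace ℝ (Fin d)) (_ : ∀ j, y j ∈ Metric.closedBall 0 R)
        (φ : EuclideanSpace ℝ (Fin d) → EReal) (_ : IsBrenierPotential μ (discreteMeasure b y) φ),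
        (∀ᵐ x ∂μ, IsDifferentiableAt φ x) ∧
        ∀ (n : ℕ) (_ : 0 < n) (Ω : Type*) [MeasurableSpace Ω] (P : Measure Ω)
          [IsProbabilityMeasure P] (X : Fin n → Ω → EuclideanSpace ℝ (Fin d))
          (_ : ∀ i, HasLaw (X i) μ P) (_ : iIndepFun X P) (g : Ω → Fin m → ℝ)
          (T : Ω → EuclideanSpace ℝ (Fin d) → EuclideanSpace ℝ (Fin d))
          (_ : ∀ᵐ ω ∂P, IsMongeMapEstimator
            (fun _ => 1 / (n : ℝ)) (fun i => X i ω) b y (g ω) (T ω)),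
          ∫⁻ ω, ∫⁻ x, ‖grad φ x - T ω x‖ₑ ∂μ ∂P
            ≤ ENNReal.ofReal (C * min 1 ((m : ℝ) / n) ^ (1 / 6 : ℝ)) := by
  obtain ⟨d₀, hd₀⟩ := exists_dimension_bound M R
  let c (d : ℕ) : ℝ := rateConst (EuclideanSpace ℝ (Fin d)) M R
  have hc (d : ℕ) : 0 ≤ c d := rateConst_nonneg _ M R
  refine ⟨1 + ∑ d ∈ Finset.range d₀, c d,
    add_pos_of_pos_of_nonneg one_pos (Finset.sum_nonneg fun d _ => hc d), ?_⟩
  intro d μ _ hsupp hdens m hm b hb y hy φ hφ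
  have : NeZero m := ⟨hm.ne'⟩
  have hnorm : ∀ᵐ x ∂μ, ‖x‖ ≤ R := Filter.mem_of_superset Measure.support_mem_ae fun x hx =>
    mem_closedBall_zero_iff.1 (hsupp hx)
  have hle := hdens.le_smul_restrict hnorm
  rw [ENNReal.ofReal_coe_nnreal] at hle
  have hac : μ ≪ volume :=
    (hle.absolutelyContinuous.trans Measure.smul_absolutelyContinuous).trans
      Measure.restrict_le_self.absolutelyContinuous
  refine ⟨hφ.ae_isDifferentiableAt hnorm hac hb, fun n hn Ω _ P _ X hX hind g T hT => ?_⟩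
  have : NeZero n := ⟨hn.ne'⟩
  have hcd : c d ≤ 1 + ∑ d ∈ Finset.range d₀, c d :=
    (Finset.single_le_sum (fun d _ => hc d) (Finset.mem_range.2 (hd₀ d μ hle))).trans
      (le_add_of_nonneg_left zero_le_one)
  refine (lintegral_enorm_sub_le_rateConst_mul_rpow hle hX hind hb
    (fun j => mem_closedBall_zero_iff.1 (hy j)) (hφ.semidual_conjugateWeights_le hnorm hb)
    (hφ.ae_grad_mem_subdifferential hnorm hac hb) hT).trans (ENNReal.ofReal_le_ofReal ?_)
  gcongr

theorem mainTheorem6 (M R : ℝ) (hM : 0 < M) (hR : 0 < R) :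
    ∃ C : ℝ, 0 < C ∧
      ∀ (d : ℕ) (_ : 1 ≤ d)
        -- the source measure
        (μ : Measure (EuclideanSpace ℝ (Fin d))) [IsProbabilityMeasure μ]
        (_ : μ.support ⊆ Metric.ball 0 R)
        (_ : SemiDiscreteOT.HasDensityBoundedBy μ M)
        -- the target measure `∑ j, b j δ_{y j}`
        (m : ℕ) (_ : 1 < m)
        (b : Fin m → ℝ) (_ : ∀ j, 0 < b j) (_ : ∑ j, b j = 1)
        (y : Fin m → EuclideanSpace ℝ (Fin d)) (_ : ∀ j, y j ∈ Metric.ball 0 R)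
        -- an optimal Brenier potential
        (φ : EuclideanSpace ℝ (Fin d) → EReal)
        (_ : SemiDiscreteOT.IsBrenierPotential μ (SemiDiscreteOT.discreteMeasure b y) φ),
        (∀ᵐ x ∂μ, SemiDiscreteOT.IsDifferentiableAt φ x) ∧
        ∀ (n : ℕ) (_ : 0 < n)
          -- the i.i.d. sample
          (Ω : Type*) [MeasurableSpace Ω] (P : Measure Ω) [IsProbabilityMeasure P]
          (X : Fin n → Ω → EuclideanSpace ℝ (Fin d))
          (_ : ∀ i, HasLaw (X i) μ P) (_ : iIndepFun X P)
          -- the estimator built from the empirical measure and the target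
          (g : Ω → Fin m → ℝ) (_ : AEMeasurable g P)
          (T : Ω → EuclideanSpace ℝ (Fin d) → EuclideanSpace ℝ (Fin d))
          (_ : ∀ᵐ ω ∂P, SemiDiscreteOT.IsMongeMapEstimator
            (fun _ => 1 / (n : ℝ)) (fun i => X i ω) b y (g ω) (T ω)),
          ∫⁻ ω, ∫⁻ x, ‖SemiDiscreteOT.grad φ x - T ω x‖ₑ ∂μ ∂P
            ≤ ENNReal.ofReal (C * ((m : ℝ) / n) ^ (1 / 8 : ℝ)) := by
  lift M to NNReal using hM.le
  lift R to NNReal using hR.le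
  obtain ⟨C, hC, h⟩ := mainTheorem6_general M R
  refine ⟨C, hC, fun d _ μ _ hsupp hdens m hm b hb _ y hy φ hφ => ?_⟩
  obtain ⟨hdiff, hrate⟩ := h d μ (hsupp.trans Metric.ball_subset_closedBall) hdens m (by omega) b hb
    y (fun j => Metric.ball_subset_closedBall (hy j)) φ hφ
  refine ⟨hdiff, fun n hn Ω _ P _ X hX hind g _ T hT =>
    (hrate n hn Ω P X hX hind g T hT).trans (ENNReal.ofReal_le_ofReal ?_)⟩
  have : (0 : ℝ) < m := by exact_mod_cast (by omega : 0 < m)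
  gcongr
  exact SemiDiscreteOT.min_one_rpow_le_rpow (by positivity) (by norm_num) (by norm_num)
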